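/- **Conventions (computability logic).** The players are the machine $\top$ and the environment $\bot$. A *move* is a finite string over the keyboard alphabet; a *run* is a finite or infinite sequence of moves labelled by the players who made them; a *position* is a finite run. A *constant game* $A$ is given by a set of legal positions that contains the empty one and is closed under initial segments (a run is legal iff all its finite initial segments are), and by a winner for every run, where the player who makes the first illegal move loses. Constants are the natural numbers, written in decimal; a *valuation* $e$ maps variables to constants; a *game* is a function from valuations to constant games. An *elementary* game has no legal moves and is won by $\top$ at $e$ iff a given predicate of $e$ holds. The operations on games are as follows. * $\neg A$ interchanges the players. * In $A\wedge B$ and $A\vee B$ both components are played in parallel (moves $1.\beta$ and $2.\beta$), and $\top$ must win both, respectively at least one, of them; $A\to B$ is $\neg A\vee B$. * In $\sqcap xA(x)$ (respectively $\sqcup xA(x)$) the first move is the choice of a constant $c$ by $\bot$ (respectively $\top$), after which $A(c)$ is played; if no choice is made, $\top$ (respectively $\bot$) wins. * Branching recurrences. An *actual node* of a position $\Phi$ is a bit string that is empty or of the form $u0$ or $u1$ where $\Phi$ contains the move "$u$:"; a *leaf* is an actual node that is not a proper prefix of another actual node. For an infinite bit string $x$, $\Theta^{\preceq x}$ is obtained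 from the run $\Theta$ by keeping only the moves of the form $u.\beta$ with $u$ an initial segment of $x$ and replacing each of them by $\beta$. The legal moves in a position $\Phi$, both of the uncountable branching recurrence $⫯A$ and of the countable branching recurrence $⫯^{\aleph_0}A$, are: "$w$:" by $\bot$, where $w$ is a leaf of $\Phi$; and $w.\alpha$ by either player $\wp$, where $w$ is an actual node of $\Phi$ and, for every infinite bit string $v$, $\alpha$ is a legal move by $\wp$ in the position $\Phi^{\preceq wv}$ of $A$. A legal run $\Gamma$ is won by $\top$ in $⫯A$ iff $\Gamma^{\preceq v}$ is won by $\top$ in $A$ for every infinite bit string $v$; in $⫯^{\aleph_0}A$ this is required only for those $v$ that contain finitely many $1$s. A *hard-play machine* (HPM) is a deterministic Turing machine with a work tape, a read-only tape spelling the valuation, and a read-only run tape spelling the current position. In each computation step it may make at most one move, while the environment may make any finite number of arbitrary moves; all these moves are appended to the run tape. An HPM *computes* a game $A$ iff, for every valuation $e$, every run that it can generate on $e$, against any behaviour of the environment, is won by $\top$ in $A$ at $e$. An *interpretation* sends each $n$-ary elementary letter to an elementary game with an attached tuple of $n$ distinct variables; it is *admissible* for a formula $F$ iff the game assigned to any letter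 of $F$ does not depend on variables that occur in $F$ but are not in the attached tuple. A formula $F$ is *uniformly valid* iff there is a single HPM that computes $F^*$ for every interpretation $^*$ admissible for $F$. **Theorem.** Let $p$ be a binary elementary letter and let $x,y$ be distinct variables. Both for $!=⫯$ and for $!=⫯^{\aleph_0}$, the instance $$\sqcup x\sqcap y\,p(x,y)\ \wedge\ !\Bigl(\sqcup x\sqcap y\,p(x,y)\to\bigl(\sqcup x\sqcap y\,p(x,y)\wedge\sqcup x\sqcap y\,p(x,y)\bigr)\Bigr)\ \to\ !\,\sqcup x\sqcap y\,p(x,y)$$ of the short production principle $P\wedge\,!(P\to P\wedge P)\to\,!P$ is not uniformly valid. -/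

import Mathlib

namespace CoL

/-! ### Players, moves, positions, runs -/

/-- The two players: the machine `⊤` and the environment `⊥`. -/
inductive Player : Type
  | machine : Player
  | environment : Player

/-- The adversary of a player. -/
def Player.other : Player → Player
  | Player.machine => Player.environment
  | Player.environment => Player.machine

/-- The keyboard alphabet: the ten decimal digits, the period, the colon, and the remaining
printable characters. -/
inductive Key : Type
  | digit (d : Fin 10) : Key
  | dot : Key
  | colon : Key
  | misc (n : Fin 83) : Key
  deriving DecidableEq

/-- A move is a finite string over the keyboard alphabet. -/
abbrev Move : Type := List Key

/-- A labmove is a move together with the player who made it. -/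
abbrev LabMove : Type := Player × Move

/-- A position is a finite sequence of labmoves. -/
abbrev Position : Type := List LabMove

/-- A run is a finite or infinite sequence of labmoves. It is represented by the set of all of
its finite initial segments: a nonempty set of positions that is closed under initial segments
and linearly ordered by the initial segment relation. -/
structure Run : Type where
  /-- the finite initial segments of the run -/
  positions : Set Position
  nil_mem : [] ∈ positions
  prefix_mem : ∀ {Φ Ψ : Position}, Φ <+: Ψ → Ψ ∈ positions → Φ ∈ positions
  chain : ∀ {Φ Ψ : Position}, Φ ∈ positions → Ψ ∈ positions → Φ <+: Ψ ∨ Ψ <+: Φ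

theorem prefix_filterMap {α β : Type} (f : α → Option β) :
    ∀ (l : List α) (m : List β), m <+: l.filterMap f → ∃ l', l' <+: l ∧ l'.filterMap f = m := by
  intro l
  induction l with
  | nil =>
    intro m hm
    exact ⟨[], List.prefix_rfl, by simpa [eq_comm] using hm⟩
  | cons a l ih =>
    intro m hm
    cases hfa : f a with
    | none =>
      rw [List.filterMap_cons_none hfa] at hm
      obtain ⟨l', h1, h2⟩ := ih m hm
      exact ⟨a :: l', by simpa using h1, by rw [List.filterMap_cons_none hfa, h2]⟩
    | some b =>
      rw [List.filterMap_cons_some hfa] at hm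
      cases m with
      | nil => exact ⟨[], List.nil_prefix, rfl⟩
      | cons c m =>
        rw [List.cons_prefix_cons] at hm
        obtain ⟨l', h1, h2⟩ := ih m hm.2
        exact ⟨a :: l', by simpa using h1, by rw [List.filterMap_cons_some hfa, h2, hm.1]⟩

/-- Apply `f` to the successive labmoves of a run, deleting those on which `f` is undefined. -/
def Run.filterMap (f : LabMove → Option LabMove) (Γ : Run) : Run where
  positions := (fun Φ : Position => Φ.filterMap f) '' Γ.positions
  nil_mem := ⟨[], Γ.nil_mem, rfl⟩
  prefix_mem := by
    rintro Φ _ h ⟨Ψ, hΨ, rfl⟩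
    obtain ⟨Ψ', h1, h2⟩ := prefix_filterMap f Ψ Φ h
    exact ⟨Ψ', Γ.prefix_mem h1 hΨ, h2⟩
  chain := by
    rintro _ _ ⟨Φ, hΦ, rfl⟩ ⟨Ψ, hΨ, rfl⟩
    exact (Γ.chain hΦ hΨ).imp (fun h => h.filterMap f) (fun h => h.filterMap f)

/-- Reversal of the label of a labmove. -/
def LabMove.neg (l : LabMove) : LabMove := (l.1.other, l.2)

/-- The negation of a run: all labels are reversed. -/
def Run.neg (Γ : Run) : Run := Γ.filterMap fun l => some (LabMove.neg l)

theorem prefix_tail {α : Type} {l m : List α} (h : l <+: m) : l.tail <+: m.tail := by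
  obtain ⟨t, rfl⟩ := h
  cases l with
  | nil => exact List.nil_prefix
  | cons a l => exact List.prefix_append _ _

/-- The run without its first labmove. -/
def Run.tail (Γ : Run) : Run where
  positions := List.tail '' Γ.positions
  nil_mem := ⟨[], Γ.nil_mem, rfl⟩
  prefix_mem := by
    rintro Φ _ h ⟨Ψ, hΨ, rfl⟩
    cases Ψ with
    | nil => exact ⟨[], Γ.nil_mem, by simpa [eq_comm] using h⟩
    | cons a Ψ =>
      exact ⟨a :: Φ, Γ.prefix_mem (by simpa using h) hΨ, rfl⟩
  chain := by
    rintro _ _ ⟨Φ, hΦ, rfl⟩ ⟨Ψ, hΨ, rfl⟩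
    exact (Γ.chain hΦ hΨ).imp prefix_tail prefix_tail

/-! ### Constant games -/

/-- Given a set of legal positions, the run `Γ` is `℘`-illegal: it is illegal, and the last
labmove of its shortest illegal initial segment is by `℘`. -/
def IllegalBy (legal : Set Position) (p : Player) (Γ : Run) : Prop :=
  ∃ (Φ : Position) (α : Move),
    Φ ++ [(p, α)] ∈ Γ.positions ∧ Φ ∈ legal ∧ Φ ++ [(p, α)] ∉ legal

/-- A constant game: its legal positions (a run is legal iff all of its finite initial segments
are) and the winner of every run, where a player who makes the first illegal move loses. -/
structure ConstGame : Type where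
  legal : Set Position
  nil_legal : [] ∈ legal
  prefix_legal : ∀ {Φ Ψ : Position}, Φ <+: Ψ → Ψ ∈ legal → Φ ∈ legal
  Wn : Run → Player
  wn_illegal : ∀ (p : Player) (Γ : Run), IllegalBy legal p Γ → Wn Γ = p.other

/-- A run is legal iff all of its finite initial segments are. -/
def LegalRun (legal : Set Position) (Γ : Run) : Prop := Γ.positions ⊆ legal

open Classical in
/-- The winner of a run, when `win` says which legal runs are won by the machine: an illegal
run is lost by the player who made the first illegal move. -/
noncomputable def winner (legal : Set Position) (win : Run → Prop) (Γ : Run) : Player :=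
  if (LegalRun legal Γ ∧ win Γ) ∨ IllegalBy legal Player.environment Γ then Player.machine
  else Player.environment

/-- The constant game with the given legal positions in which a legal run `Γ` is won by the
machine iff `win Γ`. -/
noncomputable def ConstGame.ofLegal (legal : Set Position) (nil_legal : [] ∈ legal)
    (prefix_legal : ∀ {Φ Ψ : Position}, Φ <+: Ψ → Ψ ∈ legal → Φ ∈ legal)
    (win : Run → Prop) : ConstGame where
  legal := legal
  nil_legal := nil_legal
  prefix_legal := prefix_legal
  Wn := winner legal win
  wn_illegal := by
    intro p Γ h
    cases p with
    | environment =>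
      unfold winner
      rw [if_pos (Or.inr h)]
      rfl
    | machine =>
      unfold winner
      rw [if_neg]
      · rfl
      · obtain ⟨Φ, α, h1, h2, h3⟩ := h
        rintro (⟨h4, -⟩ | ⟨Ψ, β, h4, h5, h6⟩)
        · exact h3 (h4 h1)
        · rcases Γ.chain h1 h4 with h7 | h7
          · rcases List.prefix_concat_iff.1 h7 with h8 | h8
            · simp at h8
            · exact h3 (prefix_legal h8 h5)
          · rcases List.prefix_concat_iff.1 h7 with h8 | h8
            · simp at h8
            · exact h6 (prefix_legal h8 h2)

/-! ### Operations on constant games -/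

/-- The elementary game (no legal moves) won by the machine iff `P` holds. -/
noncomputable def ConstGame.elementary (P : Prop) : ConstGame :=
  ConstGame.ofLegal {Φ | Φ = []} rfl
    (by rintro Φ Ψ h rfl; simpa using h) (fun _ => P)

/-- Negation: the players switch roles. -/
noncomputable def ConstGame.neg (A : ConstGame) : ConstGame :=
  ConstGame.ofLegal {Φ | Φ.map LabMove.neg ∈ A.legal} A.nil_legal
    (fun h hΨ => A.prefix_legal (h.map LabMove.neg) hΨ)
    (fun Γ => A.Wn Γ.neg = Player.environment)

/-- If the move is `i.β`, where `i` is a single digit, return `β`. -/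
def stripComponent (i : Fin 10) : Move → Option Move
  | k :: l :: β => if k = Key.digit i ∧ l = Key.dot then some β else none
  | _ => none

/-- The labmove played in the `i`th component, if there is one. -/
def inComponent (i : Fin 10) (l : LabMove) : Option LabMove :=
  (stripComponent i l.2).map fun β => (l.1, β)

/-- The legal positions of a parallel combination of `A` and `B`: every move is `1.β` or `2.β`,
the moves `1.β` form a legal position of `A`, and the moves `2.β` one of `B`. -/
def parLegal (A B : ConstGame) : Set Position :=
  {Φ | (∀ l ∈ Φ, (inComponent 1 l).isSome ∨ (inComponent 2 l).isSome) ∧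
    Φ.filterMap (inComponent 1) ∈ A.legal ∧ Φ.filterMap (inComponent 2) ∈ B.legal}

theorem parLegal_prefix (A B : ConstGame) {Φ Ψ : Position} (h : Φ <+: Ψ)
    (hΨ : Ψ ∈ parLegal A B) : Φ ∈ parLegal A B :=
  ⟨fun l hl => hΨ.1 l (h.subset hl), A.prefix_legal (h.filterMap _) hΨ.2.1,
    B.prefix_legal (h.filterMap _) hΨ.2.2⟩

theorem parLegal_nil (A B : ConstGame) : [] ∈ parLegal A B :=
  ⟨by simp, A.nil_legal, B.nil_legal⟩

/-- Parallel conjunction: the machine has to win both components. -/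
noncomputable def ConstGame.pand (A B : ConstGame) : ConstGame :=
  ConstGame.ofLegal (parLegal A B) (parLegal_nil A B) (parLegal_prefix A B)
    (fun Γ => A.Wn (Γ.filterMap (inComponent 1)) = Player.machine ∧
      B.Wn (Γ.filterMap (inComponent 2)) = Player.machine)

/-- Parallel disjunction: the machine has to win at least one component. -/
noncomputable def ConstGame.por (A B : ConstGame) : ConstGame :=
  ConstGame.ofLegal (parLegal A B) (parLegal_nil A B) (parLegal_prefix A B)
    (fun Γ => A.Wn (Γ.filterMap (inComponent 1)) = Player.machine ∨
      B.Wn (Γ.filterMap (inComponent 2)) = Player.machine)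

/-- The decimal numeral of a natural number. The constants are the decimal numerals, which are
identified with the natural numbers. -/
def numeral (n : ℕ) : Move :=
  if n = 0 then [Key.digit 0] else (Nat.digits 10 n).reverse.map fun d => Key.digit (Fin.ofNat 10 d)

/-- The legal positions of a choice by the player `p` of one of the games `A 0, A 1, …`: either
nothing has been played yet, or the first move is the choice by `p` of a constant `c`, and the
rest is a legal position of `A c`. -/
def choiceLegal (p : Player) (A : ℕ → ConstGame) : Set Position :=
  {Φ | Φ = [] ∨ ∃ (c : ℕ) (Δ : Position), Φ = (p, numeral c) :: Δ ∧ Δ ∈ (A c).legal}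

theorem choiceLegal_prefix (p : Player) (A : ℕ → ConstGame) {Φ Ψ : Position} (h : Φ <+: Ψ)
    (hΨ : Ψ ∈ choiceLegal p A) : Φ ∈ choiceLegal p A := by
  rcases hΨ with rfl | ⟨c, Δ, rfl, hΔ⟩
  · exact Or.inl (by simpa using h)
  · cases Φ with
    | nil => exact Or.inl rfl
    | cons a Φ =>
      rw [List.cons_prefix_cons] at h
      exact Or.inr ⟨c, Φ, by rw [h.1], (A c).prefix_legal h.2 hΔ⟩

/-- Choice conjunction of `A 0, A 1, …`: the environment chooses; the machine wins if no choice
is made. -/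
noncomputable def ConstGame.chooseAll (A : ℕ → ConstGame) : ConstGame :=
  ConstGame.ofLegal (choiceLegal Player.environment A) (Or.inl rfl)
    (choiceLegal_prefix Player.environment A)
    (fun Γ => ∀ c : ℕ, [(Player.environment, numeral c)] ∈ Γ.positions →
      (A c).Wn Γ.tail = Player.machine)

/-- Choice disjunction of `A 0, A 1, …`: the machine chooses; the environment wins if no choice
is made. -/
noncomputable def ConstGame.chooseEx (A : ℕ → ConstGame) : ConstGame :=
  ConstGame.ofLegal (choiceLegal Player.machine A) (Or.inl rfl)
    (choiceLegal_prefix Player.machine A)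
    (fun Γ => ∃ c : ℕ, [(Player.machine, numeral c)] ∈ Γ.positions ∧
      (A c).Wn Γ.tail = Player.machine)

/-! ### Branching recurrences -/

/-- A bit, as a keyboard character. -/
def bitKey (b : Bool) : Key := if b then Key.digit 1 else Key.digit 0

/-- The replicative move `w:`. -/
def replicative (w : List Bool) : Move := w.map bitKey ++ [Key.colon]

/-- The non-replicative move `w.α`. -/
def nonReplicative (w : List Bool) (α : Move) : Move := w.map bitKey ++ Key.dot :: α

/-- An actual node of `Φ`: the empty bit string, or `u0` or `u1` where `Φ` contains `u:`. -/
def ActualNode (Φ : Position) (w : List Bool) : Prop :=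
  w = [] ∨ ∃ (u : List Bool) (b : Bool) (p : Player), w = u ++ [b] ∧ (p, replicative u) ∈ Φ

/-- A leaf of `Φ`: an actual node that is not a proper prefix of any other actual node. -/
def IsLeaf (Φ : Position) (w : List Bool) : Prop :=
  ActualNode Φ w ∧ ∀ w' : List Bool, ActualNode Φ w' → w <+: w' → w' = w

/-- If the move is `u.β` for some initial segment `u` of the infinite bit string `x`,
return `β`. -/
def stripThread : (ℕ → Bool) → Move → Option Move
  | _, [] => none
  | x, k :: m =>
    if k = Key.dot then some m
    else if k = bitKey (x 0) then stripThread (fun n => x (n + 1)) m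
    else none

/-- The labmove as played in the thread `x`, if it concerns that thread. Deleting from `Θ` all
the other labmoves yields `Θ^{≼x}`. -/
def inThread (x : ℕ → Bool) (l : LabMove) : Option LabMove :=
  (stripThread x l.2).map fun β => (l.1, β)

/-- The infinite bit string `wv`. -/
def appendBits (w : List Bool) (v : ℕ → Bool) (n : ℕ) : Bool :=
  if h : n < w.length then w[n] else v (n - w.length)

/-- The legal labmoves in the position `Φ` of a branching recurrence of `A`. -/
def BranchLegalMove (A : ConstGame) (Φ : Position) (l : LabMove) : Prop :=
  (∃ w : List Bool, IsLeaf Φ w ∧ l = (Player.environment, replicative w)) ∨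
  (∃ (w : List Bool) (p : Player) (α : Move), ActualNode Φ w ∧ l = (p, nonReplicative w α) ∧
    ∀ v : ℕ → Bool, Φ.filterMap (inThread (appendBits w v)) ++ [(p, α)] ∈ A.legal)

/-- The legal positions of a branching recurrence of `A`: each labmove is legal in the position
that precedes it. -/
def branchLegal (A : ConstGame) : Set Position :=
  {Φ | ∀ (Ψ : Position) (l : LabMove), Ψ ++ [l] <+: Φ → BranchLegalMove A Ψ l}

/-- The two branching recurrences. -/
inductive Recurrence : Type
  | uncountable : Recurrence
  | countable : Recurrence

/-- The threads that matter for the winner: all infinite bit strings for the uncountable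
recurrence, and the essentially finite ones (finitely many 1s) for the countable one. -/
def Recurrence.Relevant : Recurrence → (ℕ → Bool) → Prop
  | Recurrence.uncountable, _ => True
  | Recurrence.countable, v => {n : ℕ | v n = true}.Finite

/-- (Un)countable branching recurrence: the machine has to win `A` in all relevant threads. -/
noncomputable def ConstGame.branch (r : Recurrence) (A : ConstGame) : ConstGame :=
  ConstGame.ofLegal (branchLegal A)
    (by intro Ψ l h; simp at h)
    (fun h hΨ Θ l hl => hΨ Θ l (hl.trans h))
    (fun Γ => ∀ v : ℕ → Bool, r.Relevant v → A.Wn (Γ.filterMap (inThread v)) = Player.machine)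

/-! ### Formulas and interpretations -/

/-- Variables. -/
abbrev Var : Type := ℕ

/-- A valuation assigns a constant to every variable. -/
abbrev Valuation : Type := Var → ℕ

/-- A game: a constant game for every valuation. -/
abbrev Game : Type := Valuation → ConstGame

/-- A term is a variable or a constant. -/
inductive Term : Type
  | var (x : Var) : Term
  | const (c : ℕ) : Term

/-- The value of a term under a valuation. -/
def Term.eval (e : Valuation) : Term → ℕ
  | Term.var x => e x
  | Term.const c => c

/-- The variables of a term. -/
def Term.vars : Term → Set Var
  | Term.var x => {x}
  | Term.const _ => ∅

/-- Formulas over elementary letters: `atom n i t` is the `i`th `n`-ary elementary letter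
applied to the terms `t`; `neg`, `pand`, `por` are `¬`, `∧`, `∨`; `chooseAll`, `chooseEx` are the
choice quantifiers `⊓`, `⊔`; `branch r` are the branching recurrences. -/
inductive Formula : Type
  | atom (n i : ℕ) (t : Fin n → Term) : Formula
  | neg (F : Formula) : Formula
  | pand (F G : Formula) : Formula
  | por (F G : Formula) : Formula
  | chooseAll (x : Var) (F : Formula) : Formula
  | chooseEx (x : Var) (F : Formula) : Formula
  | branch (r : Recurrence) (F : Formula) : Formula

/-- `F → G` abbreviates `¬F ∨ G`. -/
def Formula.imp (F G : Formula) : Formula := Formula.por (Formula.neg F) G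

/-- The variables that occur in a formula. -/
def Formula.vars : Formula → Set Var
  | Formula.atom _ _ t => ⋃ j, (t j).vars
  | Formula.neg F => F.vars
  | Formula.pand F G => F.vars ∪ G.vars
  | Formula.por F G => F.vars ∪ G.vars
  | Formula.chooseAll x F => insert x F.vars
  | Formula.chooseEx x F => insert x F.vars
  | Formula.branch _ F => F.vars

/-- The letters (arity, index) that occur in a formula. -/
def Formula.letters : Formula → Set (ℕ × ℕ)
  | Formula.atom n i _ => {(n, i)}
  | Formula.neg F => F.letters
  | Formula.pand F G => F.letters ∪ G.letters
  | Formula.por F G => F.letters ∪ G.letters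
  | Formula.chooseAll _ F => F.letters
  | Formula.chooseEx _ F => F.letters
  | Formula.branch _ F => F.letters

/-- An interpretation sends every `n`-ary elementary letter to an elementary game, given by the
set of valuations at which it is won by the machine, with an attached tuple of `n` distinct
variables. -/
structure Interpretation : Type where
  tuple : (n i : ℕ) → Fin n → Var
  tuple_injective : ∀ n i : ℕ, Function.Injective (tuple n i)
  holds : (n i : ℕ) → Valuation → Prop

/-- A predicate of valuations depends on the variable `z`. -/
def DependsOn (P : Valuation → Prop) (z : Var) : Prop :=
  ∃ e e' : Valuation, (∀ x : Var, x ≠ z → e x = e' x) ∧ ¬ (P e ↔ P e')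

/-- The interpretation is admissible for `F`: the game assigned to a letter of `F` does not
depend on any variable that occurs in `F` without being in the attached tuple. -/
def Interpretation.Admissible (I : Interpretation) (F : Formula) : Prop :=
  ∀ n i : ℕ, (n, i) ∈ F.letters → ∀ z ∈ F.vars, z ∉ Set.range (I.tuple n i) →
    ¬ DependsOn (I.holds n i) z

/-- The game into which an interpretation turns a formula. In an atom, the terms are
substituted for the variables of the attached tuple. -/
noncomputable def Formula.toGame (I : Interpretation) : Formula → Game
  | Formula.atom n i t => fun e =>
      ConstGame.elementary
        (I.holds n i (Function.extend (I.tuple n i) (fun j => (t j).eval e) e))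
  | Formula.neg F => fun e => (F.toGame I e).neg
  | Formula.pand F G => fun e => (F.toGame I e).pand (G.toGame I e)
  | Formula.por F G => fun e => (F.toGame I e).por (G.toGame I e)
  | Formula.chooseAll x F => fun e =>
      ConstGame.chooseAll fun c => F.toGame I (Function.update e x c)
  | Formula.chooseEx x F => fun e =>
      ConstGame.chooseEx fun c => F.toGame I (Function.update e x c)
  | Formula.branch r F => fun e => (F.toGame I e).branch r

/-! ### Hard-play machines -/

/-- Movements of a tape head. -/
inductive Dir : Type
  | left : Dir
  | stay : Dir
  | right : Dir

/-- Move a head on a one-way infinite tape. -/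
def Dir.apply : Dir → ℕ → ℕ
  | Dir.left, n => n - 1
  | Dir.stay, n => n
  | Dir.right, n => n + 1

/-- A hard-play machine: a deterministic Turing machine with a read/write work tape and two
read-only tapes, the valuation tape and the run tape. A work tape cell holds a keyboard
character, one of finitely many extra symbols, or the blank `none`; a valuation tape cell a
keyboard character or the separator `none`; a run tape cell a label, a keyboard character, or
the blank `none`. In one step the machine changes its state, rewrites the scanned cell of the
work tape, and moves the heads of the work, valuation and run tape. -/
structure HPM : Type 1 where
  State : Type
  finite_state : Finite State
  Extra : Type
  finite_extra : Finite Extra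
  start : State
  moveStates : Set State
  trans : State → Option (Key ⊕ Extra) → Option Key → Option (Player ⊕ Key) →
    State × Option (Key ⊕ Extra) × Dir × Dir × Dir

/-- The `i`th cell of the valuation tape, which spells the values of the variables one after
another, each followed by a separator. -/
def valuationTape (e : Valuation) (i : ℕ) : Option Key :=
  ((List.range (i + 1)).flatMap fun x => (numeral (e x)).map some ++ [none]).getD i none

/-- The `i`th cell of the run tape, which spells the labmoves of the current position. -/
def runTape (Φ : Position) (i : ℕ) : Option (Player ⊕ Key) :=
  (Φ.flatMap fun l => Sum.inl l.1 :: l.2.map Sum.inr)[i]?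

/-- A configuration of a hard-play machine. -/
structure HPM.Config (M : HPM) : Type where
  state : M.State
  work : ℕ → Option (Key ⊕ M.Extra)
  workHead : ℕ
  valHead : ℕ
  runHead : ℕ
  position : Position

/-- The initial configuration. -/
def HPM.init (M : HPM) : M.Config where
  state := M.start
  work := fun _ => none
  workHead := 0
  valHead := 0
  runHead := 0
  position := []

/-- One step of the machine on the valuation `e`, before the update of the run tape. -/
def HPM.next (M : HPM) (e : Valuation) (C : M.Config) : M.Config :=
  match M.trans C.state (C.work C.workHead) (valuationTape e C.valHead)
      (runTape C.position C.runHead) with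
  | (q, s, dw, dv, dr) =>
    { state := q
      work := Function.update C.work C.workHead s
      workHead := dw.apply C.workHead
      valHead := dv.apply C.valHead
      runHead := dr.apply C.runHead
      position := C.position }

/-- The keyboard string at the beginning of the work tape, to the left of the head. -/
def HPM.Config.buffer {M : HPM} (C : M.Config) : Move :=
  (((List.range C.workHead).map C.work).takeWhile fun s => (s.bind Sum.getLeft?).isSome).filterMap
    fun s => s.bind Sum.getLeft?

open Classical in
/-- The move made by the machine when it enters the configuration `C`: if the state is a move
state, the string in the buffer; otherwise none. -/
noncomputable def HPM.Config.moveMade {M : HPM} (C : M.Config) : Position :=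
  if C.state ∈ M.moveStates then [(Player.machine, C.buffer)] else []

/-- `C'` is a successor of `C`: the machine makes one step and thereby at most one move, the
environment makes finitely many arbitrary moves, and these moves are appended to the run tape,
the order between the two players being arbitrary. -/
def HPM.Succ (M : HPM) (e : Valuation) (C C' : M.Config) : Prop :=
  ∃ before after : List Move,
    C' = { M.next e C with
      position := C.position ++ before.map (fun α => (Player.environment, α)) ++
        (M.next e C).moveMade ++ after.map (fun α => (Player.environment, α)) }

/-- A computation branch of the machine on the valuation `e`. -/
structure HPM.Branch (M : HPM) (e : Valuation) : Type where
  config : ℕ → M.Config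
  config_zero : config 0 = M.init
  config_succ : ∀ k : ℕ, M.Succ e (config k) (config (k + 1))

theorem HPM.Branch.position_prefix {M : HPM} {e : Valuation} (B : M.Branch e) {i j : ℕ}
    (h : i ≤ j) : (B.config i).position <+: (B.config j).position := by
  induction h with
  | refl => exact List.prefix_rfl
  | step _ ih =>
    refine ih.trans ?_
    obtain ⟨before, after, hC⟩ := B.config_succ _
    rw [hC]
    simp only [List.append_assoc]
    exact List.prefix_append _ _

/-- The run spelled by a computation branch. -/
def HPM.Branch.run {M : HPM} {e : Valuation} (B : M.Branch e) : Run where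
  positions := {Φ | ∃ k : ℕ, Φ <+: (B.config k).position}
  nil_mem := ⟨0, List.nil_prefix⟩
  prefix_mem := by
    rintro Φ Ψ h ⟨k, hk⟩
    exact ⟨k, h.trans hk⟩
  chain := by
    rintro Φ Ψ ⟨i, hi⟩ ⟨j, hj⟩
    exact List.prefix_or_prefix_of_prefix
      (hi.trans (B.position_prefix (le_max_left i j)))
      (hj.trans (B.position_prefix (le_max_right i j)))

/-- The machine `M` computes (wins) the game `A`: on every valuation `e`, every run that `M` can
generate is won by the machine in the constant game `A e`. -/
def HPM.Computes (M : HPM) (A : Game) : Prop :=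
  ∀ (e : Valuation) (B : M.Branch e), (A e).Wn B.run = Player.machine

/-- Uniform validity: one and the same machine wins the game under all admissible
interpretations. -/
def UniformlyValid (F : Formula) : Prop :=
  ∃ M : HPM, ∀ I : Interpretation, I.Admissible F → M.Computes (F.toGame I)

/-! ### Short production -/

/-- The short production principle `P ∧ !(P → P ∧ P) → !P`. -/
def shortProduction (r : Recurrence) (P : Formula) : Formula :=
  Formula.imp
    (Formula.pand P (Formula.branch r (Formula.imp P (Formula.pand P P))))
    (Formula.branch r P)

/-- The formula `⊔x⊓y p(x, y)`, where `p` is the `i`th binary elementary letter. -/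
def choiceFormula (i : ℕ) (x y : Var) : Formula :=
  Formula.chooseEx x (Formula.chooseAll y (Formula.atom 2 i ![Term.var x, Term.var y]))

end CoL

namespace CoL

/-! ### Limits of positions and winners of legal runs -/

/-! Legality in `⊔x⊓y p(x, y)` does not depend on the predicate assigned to `p`. The environment can
therefore play a fixed strategy against the given machine and choose the predicate `R` only after
the run is complete.

Arrange the constants in the binary tree with root 0 in which `a` has children `2a+1` and `2a+2`. In
the resource `P` the environment chooses 0. In a thread of `!(P → P ∧ P)`, when the machine chooses
`a` in the antecedent, the environment chooses the two children of `a` in the consequents. When the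
machine chooses `m` in the goal `!P`, the environment splits the root and answers 0 in one copy and
1 in the other (`fork`). Let `S` be the path from `m` to the root. From then on, in each thread, an
answer to the child of `a` lying in `S` is copied back as the answer to `a`.

Afterwards let `R c y` hold for all `y` if `c ∉ S`, and for `c ∈ S` only if `y` is the machine's
answer to 0 in the resource. The environment wins the resource by definition. It wins every thread
of `!(P → P ∧ P)`: a child off the path is true outright, and a child on the path gets the same
answer as `a`, which is itself on the path, so the truth of `R` passes from `a` to the child
(`duplication_wn`). This needs at most one child of `a` to be on the path. The machine would need
both `R m 0` and `R m 1` in the goal, but it gave at most one answer in the resource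
(`exists_environment_wins`).

Two points carry the bookkeeping. Until `m` is known no antecedent is answered, so every thread can
catch up (`Settled.exists_settle_of_empty`). Responses found thread by thread are turned into moves
of the recurrence at its finitely many leaves (`exists_branch_response`). -/

/-- `Γ` is the limit of the positions `Φ k`. -/
def IsLimit (Φ : ℕ → Position) (Γ : Run) : Prop :=
  ∀ S : Position, S ∈ Γ.positions ↔ ∃ k, S <+: Φ k

/-- Projections to components and threads are filters, so every part of the final run is the limit
of the corresponding parts of its positions. -/
theorem IsLimit.filterMap {Φ : ℕ → Position} {Γ : Run} (h : IsLimit Φ Γ)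
    (f : LabMove → Option LabMove) : IsLimit (fun k => (Φ k).filterMap f) (Γ.filterMap f) := by
  intro S
  constructor
  · rintro ⟨Ψ, hΨ, rfl⟩
    obtain ⟨k, hk⟩ := (h Ψ).1 hΨ
    exact ⟨k, hk.filterMap f⟩
  · rintro ⟨k, hk⟩
    obtain ⟨Ψ, h1, h2⟩ := prefix_filterMap f _ _ hk
    exact ⟨Ψ, (h Ψ).2 ⟨k, h1⟩, h2⟩

theorem IsLimit.neg {Φ : ℕ → Position} {Γ : Run} (h : IsLimit Φ Γ) :
    IsLimit (fun k => (Φ k).map LabMove.neg) Γ.neg := by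
  have := h.filterMap fun l => some (LabMove.neg l)
  simpa [Run.neg, List.filterMap_eq_map'] using this

theorem IsLimit.legalRun {Φ : ℕ → Position} {Γ : Run} (h : IsLimit Φ Γ) {A : ConstGame}
    (hΦ : ∀ k, Φ k ∈ A.legal) : LegalRun A.legal Γ := by
  intro S hS
  obtain ⟨k, hk⟩ := (h S).1 hS
  exact A.prefix_legal hk (hΦ k)

theorem Player.ne_machine {p : Player} : p ≠ Player.machine ↔ p = Player.environment := by
  cases p <;> simp

/-- On a legal run the illegality clause of `winner` is void. The hypothesis `hA` holds by `rfl` for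
every game built with `ConstGame.ofLegal`. -/
theorem wn_eq_machine_iff {A : ConstGame} {win : Run → Prop} (hA : A.Wn = winner A.legal win)
    {Γ : Run} (h : LegalRun A.legal Γ) : A.Wn Γ = Player.machine ↔ win Γ := by
  have h1 : ¬ IllegalBy A.legal Player.environment Γ := fun ⟨_, _, h2, _, h3⟩ => h3 (h h2)
  by_cases hw : win Γ <;> simp [hA, winner, h, h1, hw]

theorem neg_wn {A : ConstGame} {Γ : Run} (h : LegalRun A.neg.legal Γ) :
    A.neg.Wn Γ = Player.machine ↔ ¬ A.Wn Γ.neg = Player.machine :=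
  (wn_eq_machine_iff rfl h).trans Player.ne_machine.symm

theorem pand_wn {A B : ConstGame} {Γ : Run} (h : LegalRun (A.pand B).legal Γ) :
    (A.pand B).Wn Γ = Player.machine ↔ A.Wn (Γ.filterMap (inComponent 1)) = Player.machine ∧
      B.Wn (Γ.filterMap (inComponent 2)) = Player.machine :=
  wn_eq_machine_iff rfl h

theorem por_wn {A B : ConstGame} {Γ : Run} (h : LegalRun (A.por B).legal Γ) :
    (A.por B).Wn Γ = Player.machine ↔ A.Wn (Γ.filterMap (inComponent 1)) = Player.machine ∨
      B.Wn (Γ.filterMap (inComponent 2)) = Player.machine :=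
  wn_eq_machine_iff rfl h

theorem branch_wn {r : Recurrence} {A : ConstGame} {Γ : Run}
    (h : LegalRun (A.branch r).legal Γ) :
    (A.branch r).Wn Γ = Player.machine ↔
      ∀ v, r.Relevant v → A.Wn (Γ.filterMap (inThread v)) = Player.machine :=
  wn_eq_machine_iff rfl h

/-! ### Numerals -/

theorem numeral_injective : Function.Injective numeral := by
  have key : ∀ n, Nat.ofDigits 10 (((numeral n).reverse).map
      fun k => match k with | Key.digit d => d.val | _ => 0) = n := by
    intro n
    by_cases hn : n = 0
    · subst hn; simp [numeral]
    · conv_rhs => rw [← Nat.ofDigits_digits 10 n]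
      congr 1
      simp only [numeral, hn, if_false, List.map_reverse, List.reverse_reverse, List.map_map]
      conv_rhs => rw [← List.map_id (Nat.digits 10 n)]
      apply List.map_congr_left
      intro d hd
      have := Nat.digits_lt_base (by norm_num : 1 < 10) hd
      simp [Nat.mod_eq_of_lt this]
  intro a b h
  rw [← key a, ← key b, h]

/-! ### The game `⊔x⊓y R(x, y)` -/

/-- The constant game `⊔x⊓y R(x, y)`. -/
noncomputable def choiceGame (R : ℕ → ℕ → Prop) : ConstGame :=
  ConstGame.chooseEx fun c => ConstGame.chooseAll fun d => ConstGame.elementary (R c d)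

/-- The position of `⊔x⊓y R(x, y)` in which `c` has been chosen for `x` and, possibly, `s`
for `y`. -/
def chosen (c : ℕ) (s : Option ℕ) : Position :=
  (Player.machine, numeral c) :: (s.map fun d => (Player.environment, numeral d)).toList

theorem chosen_inj {c c' : ℕ} {s s' : Option ℕ} :
    chosen c s = chosen c' s' ↔ c = c' ∧ s = s' := by
  refine ⟨fun h => ?_, fun ⟨h, h'⟩ => by rw [h, h']⟩
  cases s <;> cases s' <;> simp_all [chosen, numeral_injective.eq_iff]

theorem chosen_none_prefix {c c' : ℕ} {s : Option ℕ} :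
    chosen c none <+: chosen c' s ↔ c = c' := by
  simp [chosen, List.cons_prefix_cons, numeral_injective.eq_iff]

theorem chosen_some_prefix {c c' d : ℕ} {s : Option ℕ} :
    chosen c (some d) <+: chosen c' s ↔ c = c' ∧ s = some d := by
  cases s <;> simp [chosen, List.cons_prefix_cons, numeral_injective.eq_iff, eq_comm]

theorem chosen_append_some (c d : ℕ) :
    chosen c none ++ [(Player.environment, numeral d)] = chosen c (some d) := rfl

/-- The right-hand side does not mention `R`; this is what allows `R` to be chosen after the run. -/
theorem mem_choiceGame_legal {R : ℕ → ℕ → Prop} {Φ : Position} :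
    Φ ∈ (choiceGame R).legal ↔ Φ = [] ∨ ∃ c s, Φ = chosen c s := by
  constructor
  · rintro (rfl | ⟨c, Δ, rfl, rfl | ⟨d, Δ', rfl, h⟩⟩)
    · exact Or.inl rfl
    · exact Or.inr ⟨c, none, rfl⟩
    · refine Or.inr ⟨c, some d, ?_⟩
      have : Δ' = [] := h
      subst this
      rfl
  · rintro (rfl | ⟨c, s, rfl⟩)
    · exact Or.inl rfl
    · refine Or.inr ⟨c, _, rfl, ?_⟩
      cases s with
      | none => exact Or.inl rfl
      | some d => exact Or.inr ⟨d, [], rfl, rfl⟩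

theorem chosen_legal {R : ℕ → ℕ → Prop} (c : ℕ) (s : Option ℕ) :
    chosen c s ∈ (choiceGame R).legal :=
  mem_choiceGame_legal.2 (Or.inr ⟨c, s, rfl⟩)

/-- The choice of `x` is the machine's only move in this game, and it comes first. -/
theorem append_machine_legal {R : ℕ → ℕ → Prop} {Φ : Position} {α : Move}
    (h : Φ ++ [(Player.machine, α)] ∈ (choiceGame R).legal) :
    Φ = [] ∧ ∃ c, α = numeral c := by
  rcases mem_choiceGame_legal.1 h with h | ⟨c, s, h⟩
  · simp at h
  · cases s with
    | none =>
      have : Φ = [] := by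
        have := congrArg List.length h
        simpa [chosen] using this
      subst this
      simp [chosen] at h
      exact ⟨rfl, c, h⟩
    | some d =>
      have := congrArg List.getLast? h
      simp [chosen] at this

theorem append_environment_legal {R : ℕ → ℕ → Prop} {Φ : Position} {α : Move}
    (h : Φ ++ [(Player.environment, α)] ∈ (choiceGame R).legal) :
    ∃ c d, Φ = chosen c none ∧ α = numeral d := by
  rcases mem_choiceGame_legal.1 h with h | ⟨c, s, h⟩
  · simp at h
  · cases s with
    | none =>
      have := congrArg List.getLast? h
      simp [chosen] at this
    | some d =>
      rw [← chosen_append_some] at h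
      have := List.append_inj' h rfl
      simp at this
      exact ⟨c, d, this⟩

/-- The positions of one run are pairwise comparable, so every nonempty one begins with the same
choice. -/
theorem legalRun_tail {p : Player} {A : ℕ → ConstGame} {Γ : Run}
    (h : LegalRun (choiceLegal p A) Γ) {c : ℕ} (hc : [(p, numeral c)] ∈ Γ.positions) :
    LegalRun (A c).legal Γ.tail := by
  rintro _ ⟨Ψ, hΨ, rfl⟩
  rcases h hΨ with rfl | ⟨c', Δ, rfl, hΔ⟩
  · exact (A c).nil_legal
  · have : c = c' := by
      rcases Γ.chain hc hΨ with h' | h' <;>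
        simp [List.cons_prefix_cons, numeral_injective.eq_iff] at h' <;> simp [h']
    subst this
    exact hΔ

theorem mem_tail_positions {Γ : Run} {a : LabMove} {Φ : Position}
    (ha : [a] ∈ Γ.positions) (hΦ : Φ ≠ []) : Φ ∈ Γ.tail.positions ↔ a :: Φ ∈ Γ.positions := by
  constructor
  · rintro ⟨Ψ, hΨ, rfl⟩
    cases Ψ with
    | nil => simp at hΦ
    | cons b Ψ =>
      have : a = b := by
        rcases Γ.chain ha hΨ with h' | h' <;> simp_all [List.cons_prefix_cons]
      subst this
      exact hΨ
  · intro h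
    exact ⟨_, h, rfl⟩

/-- Unfolding the two quantifiers. If no `y` is ever chosen, the inner condition is vacuous, which
matches the machine's win in that case. -/
theorem choiceGame_wn {R : ℕ → ℕ → Prop} {Γ : Run} (h : LegalRun (choiceGame R).legal Γ) :
    (choiceGame R).Wn Γ = Player.machine ↔
      ∃ c, chosen c none ∈ Γ.positions ∧ ∀ d, chosen c (some d) ∈ Γ.positions → R c d := by
  refine (wn_eq_machine_iff rfl h).trans (exists_congr fun c => and_congr_right fun hc => ?_)
  have h1 := legalRun_tail h hc
  refine (wn_eq_machine_iff rfl h1).trans (forall_congr' fun d => ?_)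
  rw [mem_tail_positions hc (by simp)]
  refine imp_congr_right fun hd => ?_
  have hd' : [(Player.environment, numeral d)] ∈ Γ.tail.positions := ⟨_, hd, rfl⟩
  exact wn_eq_machine_iff rfl (legalRun_tail h1 hd')

/-! ### Threads of positions of branching recurrences -/

/-- The finite bit string `w` is an initial segment of the infinite bit string `x`. -/
def Starts (w : List Bool) (x : ℕ → Bool) : Prop := ∃ v, x = appendBits w v

theorem appendBits_nil (v : ℕ → Bool) : appendBits [] v = v := by
  funext n
  simp [appendBits]

theorem appendBits_cons_zero (b : Bool) (w : List Bool) (v : ℕ → Bool) :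
    appendBits (b :: w) v 0 = b := by
  simp [appendBits]

theorem appendBits_cons_succ (b : Bool) (w : List Bool) (v : ℕ → Bool) (n : ℕ) :
    appendBits (b :: w) v (n + 1) = appendBits w v n := by
  simp [appendBits]

theorem starts_nil (x : ℕ → Bool) : Starts [] x := ⟨x, (appendBits_nil x).symm⟩

theorem starts_cons {b : Bool} {w : List Bool} {x : ℕ → Bool} :
    Starts (b :: w) x ↔ b = x 0 ∧ Starts w fun n => x (n + 1) := by
  constructor
  · rintro ⟨v, rfl⟩
    exact ⟨(appendBits_cons_zero b w v).symm, v, funext fun n => appendBits_cons_succ b w v n⟩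
  · rintro ⟨rfl, v, hv⟩
    refine ⟨v, funext fun n => ?_⟩
    cases n with
    | zero => rw [appendBits_cons_zero]
    | succ n => rw [appendBits_cons_succ, ← hv]

theorem starts_append_singleton {w : List Bool} {x : ℕ → Bool} (h : Starts w x) :
    Starts (w ++ [x w.length]) x := by
  induction w generalizing x with
  | nil => simp [starts_cons, starts_nil]
  | cons b w ih =>
    rw [starts_cons] at h
    rw [List.cons_append, starts_cons]
    exact ⟨h.1, by simpa using ih h.2⟩

theorem Starts.of_prefix {u w : List Bool} {x : ℕ → Bool} (h : Starts w x) (huw : u <+: w) :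
    Starts u x := by
  induction u generalizing w x with
  | nil => exact starts_nil x
  | cons b u ih =>
    cases w with
    | nil => simp at huw
    | cons c w =>
      rw [List.cons_prefix_cons] at huw
      rw [starts_cons] at h ⊢
      exact ⟨huw.1.trans h.1, ih h.2 huw.2⟩

theorem Starts.prefix_or_prefix {u w : List Bool} {x : ℕ → Bool} (hu : Starts u x)
    (hw : Starts w x) : u <+: w ∨ w <+: u := by
  induction u generalizing w x with
  | nil => exact Or.inl List.nil_prefix
  | cons b u ih =>
    cases w with
    | nil => exact Or.inr List.nil_prefix
    | cons c w =>
      rw [starts_cons] at hu hw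
      simpa [List.cons_prefix_cons, hu.1, hw.1] using ih hu.2 hw.2

theorem bitKey_injective : Function.Injective bitKey := by
  intro a b
  cases a <;> cases b <;> simp [bitKey]

theorem bitKey_ne_dot (b : Bool) : bitKey b ≠ Key.dot := by cases b <;> simp [bitKey]

theorem bitKey_ne_colon (b : Bool) : bitKey b ≠ Key.colon := by cases b <;> simp [bitKey]

/-- A replicative move contains no period, so reading it along any bit string fails, at the colon at
the latest. -/
theorem stripThread_replicative (x : ℕ → Bool) (w : List Bool) :
    stripThread x (replicative w) = none := by
  induction w generalizing x with
  | nil => simp [replicative, stripThread, (bitKey_ne_colon _).symm]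
  | cons b w ih =>
    have := ih fun n => x (n + 1)
    simp only [replicative] at this
    simp [replicative, stripThread, bitKey_ne_dot, this]

theorem stripThread_nonReplicative_of_starts {w : List Bool} {x : ℕ → Bool} (h : Starts w x)
    (α : Move) : stripThread x (nonReplicative w α) = some α := by
  induction w generalizing x with
  | nil => simp [nonReplicative, stripThread]
  | cons b w ih =>
    rw [starts_cons] at h
    have := ih h.2
    simp only [nonReplicative] at this
    simp [nonReplicative, stripThread, bitKey_ne_dot, h.1, this]

theorem stripThread_nonReplicative_of_not_starts {w : List Bool} {x : ℕ → Bool}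
    (h : ¬ Starts w x) (α : Move) : stripThread x (nonReplicative w α) = none := by
  induction w generalizing x with
  | nil => exact absurd (starts_nil x) h
  | cons b w ih =>
    rw [starts_cons, not_and] at h
    by_cases hb : b = x 0
    · have := ih (h hb)
      simp only [nonReplicative] at this
      simp [nonReplicative, stripThread, bitKey_ne_dot, hb, this]
    · simp [nonReplicative, stripThread, bitKey_ne_dot, bitKey_injective.eq_iff, hb]

theorem replicative_injective : Function.Injective replicative := by
  intro u w h
  have := List.append_cancel_right h
  exact List.map_injective_iff.2 bitKey_injective this

theorem replicative_ne_nonReplicative (u w : List Bool) (α : Move) :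
    replicative u ≠ nonReplicative w α := by
  intro h
  have h1 := stripThread_replicative (appendBits w fun _ => false) u
  rw [h, stripThread_nonReplicative_of_starts ⟨_, rfl⟩] at h1
  simp at h1

/-- The position `Φ^{≼x}`. -/
def thread (x : ℕ → Bool) (Φ : Position) : Position := Φ.filterMap (inThread x)

theorem thread_append (x : ℕ → Bool) (Φ Ψ : Position) :
    thread x (Φ ++ Ψ) = thread x Φ ++ thread x Ψ := List.filterMap_append

theorem thread_replicative (x : ℕ → Bool) (p : Player) (w : List Bool) :
    thread x [(p, replicative w)] = [] := by
  simp [thread, inThread, stripThread_replicative]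

theorem thread_moves_of_starts {w : List Bool} {x : ℕ → Bool} (h : Starts w x) (p : Player)
    (L : List Move) :
    thread x (L.map fun α => (p, nonReplicative w α)) = L.map fun α => (p, α) := by
  simp only [thread, List.filterMap_map]
  rw [← List.filterMap_eq_map']
  congr 1
  funext α
  simp [inThread, stripThread_nonReplicative_of_starts h]

theorem thread_moves_of_not_starts {w : List Bool} {x : ℕ → Bool} (h : ¬ Starts w x)
    (p : Player) (L : List Move) :
    thread x (L.map fun α => (p, nonReplicative w α)) = [] := by
  simp [thread, inThread, stripThread_nonReplicative_of_not_starts h]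

/-! ### Legal positions of a branching recurrence and their trees -/

theorem branchLegal_append_singleton {A : ConstGame} {Φ : Position} {l : LabMove} :
    Φ ++ [l] ∈ branchLegal A ↔ Φ ∈ branchLegal A ∧ BranchLegalMove A Φ l := by
  constructor
  · intro h
    exact ⟨fun Ψ l' h' => h Ψ l' (h'.trans (List.prefix_append _ _)), h Φ l List.prefix_rfl⟩
  · rintro ⟨h1, h2⟩ Ψ l' h
    rcases List.prefix_concat_iff.1 h with h | h
    · obtain ⟨rfl, h⟩ := List.append_inj' h rfl
      obtain rfl : l' = l := by simpa using h
      exact h2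
    · exact h1 Ψ l' h

theorem nil_mem_branchLegal (A : ConstGame) : [] ∈ branchLegal A := by
  intro Ψ l h
  simp at h

/-- A legal move changes every thread by at most one labmove, and keeps it legal. -/
theorem BranchLegalMove.thread {A : ConstGame} {Φ : Position} {p : Player} {μ : Move}
    (h : BranchLegalMove A Φ (p, μ)) (x : ℕ → Bool) :
    thread x (Φ ++ [(p, μ)]) = thread x Φ ∨
      ∃ α, thread x (Φ ++ [(p, μ)]) = thread x Φ ++ [(p, α)] ∧
        thread x Φ ++ [(p, α)] ∈ A.legal := by
  rw [thread_append]
  rcases h with ⟨w, -, h⟩ | ⟨w, q, α, -, h, h1⟩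
  · obtain ⟨rfl, rfl⟩ := Prod.mk.inj h
    left
    rw [thread_replicative, List.append_nil]
  · obtain ⟨rfl, rfl⟩ := Prod.mk.inj h
    by_cases hw : Starts w x
    · right
      refine ⟨α, ?_, ?_⟩
      · have := thread_moves_of_starts hw p [α]
        simp only [List.map_cons, List.map_nil] at this
        rw [this]
      · obtain ⟨v, rfl⟩ := hw
        exact h1 v
    · left
      have := thread_moves_of_not_starts hw p [α]
      simp only [List.map_cons, List.map_nil] at this
      rw [this, List.append_nil]

theorem thread_legal {A : ConstGame} {Φ : Position} (h : Φ ∈ branchLegal A) (x : ℕ → Bool) :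
    thread x Φ ∈ A.legal := by
  induction Φ using List.reverseRecOn with
  | nil => exact A.nil_legal
  | append_singleton Φ l ih =>
    rw [branchLegal_append_singleton] at h
    rcases BranchLegalMove.thread (p := l.1) (μ := l.2) h.2 x with h1 | ⟨α, h1, h2⟩
    · exact h1 ▸ ih h.1
    · exact h1 ▸ h2

theorem ActualNode.mono {Φ Ψ : Position} {w : List Bool} (h : ActualNode Φ w) (hs : Φ ⊆ Ψ) :
    ActualNode Ψ w := by
  rcases h with h | ⟨u, b, p, h1, h2⟩
  · exact Or.inl h
  · exact Or.inr ⟨u, b, p, h1, hs h2⟩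

theorem actualNode_append_nonReplicative {Φ : Position} {w : List Bool} {p : Player}
    {u : List Bool} {L : List Move} :
    ActualNode (Φ ++ L.map fun α => (p, nonReplicative u α)) w ↔ ActualNode Φ w := by
  refine ⟨fun h => ?_, fun h => h.mono (List.subset_append_left _ _)⟩
  rcases h with h | ⟨u', b, q, h1, h2⟩
  · exact Or.inl h
  · refine Or.inr ⟨u', b, q, h1, ?_⟩
    rcases List.mem_append.1 h2 with h2 | h2
    · exact h2
    · obtain ⟨α, -, h2⟩ := List.mem_map.1 h2
      exact absurd (congrArg Prod.snd h2).symm (replicative_ne_nonReplicative _ _ _)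

theorem isLeaf_append_nonReplicative {Φ : Position} {w : List Bool} {p : Player}
    {u : List Bool} {L : List Move} :
    IsLeaf (Φ ++ L.map fun α => (p, nonReplicative u α)) w ↔ IsLeaf Φ w := by
  simp only [IsLeaf, actualNode_append_nonReplicative]

theorem isLeaf_append_nonReplicative_singleton {Φ : Position} {w : List Bool} {p : Player}
    {u : List Bool} {α : Move} :
    IsLeaf (Φ ++ [(p, nonReplicative u α)]) w ↔ IsLeaf Φ w :=
  isLeaf_append_nonReplicative (L := [α])

theorem actualNode_append_replicative {Φ : Position} {w : List Bool} {p : Player}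
    {u : List Bool} :
    ActualNode (Φ ++ [(p, replicative u)]) w ↔ ActualNode Φ w ∨ ∃ b, w = u ++ [b] := by
  constructor
  · rintro (h | ⟨u', b, q, h1, h2⟩)
    · exact Or.inl (Or.inl h)
    · rcases List.mem_append.1 h2 with h2 | h2
      · exact Or.inl (Or.inr ⟨u', b, q, h1, h2⟩)
      · obtain ⟨-, h2⟩ := Prod.mk.inj (List.mem_singleton.1 h2)
        obtain rfl := replicative_injective h2
        exact Or.inr ⟨b, h1⟩
  · rintro (h | ⟨b, rfl⟩)
    · exact h.mono (List.subset_append_left _ _)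
    · exact Or.inr ⟨u, b, p, rfl, by simp⟩

theorem IsLeaf.append_replicative {Φ : Position} {w w' : List Bool} {p : Player}
    (hw : IsLeaf Φ w) (hw' : IsLeaf Φ w') (hne : w' ≠ w) :
    IsLeaf (Φ ++ [(p, replicative w)]) w' := by
  refine ⟨hw'.1.mono (List.subset_append_left _ _), fun u hu h => ?_⟩
  rcases actualNode_append_replicative.1 hu with hu | ⟨b, rfl⟩
  · exact hw'.2 u hu h
  · rcases List.prefix_concat_iff.1 h with h | h
    · exact h.symm
    · exact absurd (hw'.2 w hw.1 h).symm hne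

theorem IsLeaf.child {Φ : Position} {w : List Bool} {p : Player} (hw : IsLeaf Φ w) (b : Bool) :
    IsLeaf (Φ ++ [(p, replicative w)]) (w ++ [b]) := by
  refine ⟨actualNode_append_replicative.2 (Or.inr ⟨b, rfl⟩), fun u hu h => ?_⟩
  rcases actualNode_append_replicative.1 hu with hu | ⟨c, rfl⟩
  · obtain rfl := hw.2 u hu ((List.prefix_append _ _).trans h)
    have := h.length_le
    simp at this
  · exact (h.eq_of_length (by simp)).symm

/-- The tree of a legal position has finitely many leaves, and every infinite bit string passes
through one of them. -/
theorem exists_leaves {A : ConstGame} {Φ : Position} (h : Φ ∈ branchLegal A) :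
    ∃ ℓ : List (List Bool), (∀ w ∈ ℓ, IsLeaf Φ w) ∧ ∀ x, ∃ w ∈ ℓ, Starts w x := by
  induction Φ using List.reverseRecOn with
  | nil =>
    refine ⟨[[]], ?_, fun x => ⟨[], by simp, starts_nil x⟩⟩
    simp only [List.mem_singleton, forall_eq]
    refine ⟨Or.inl rfl, ?_⟩
    rintro w' (rfl | ⟨u, b, p, -, h2⟩) -
    · rfl
    · simp at h2
  | append_singleton Φ l ih =>
    rw [branchLegal_append_singleton] at h
    obtain ⟨ℓ, h1, h2⟩ := ih h.1
    rcases h.2 with ⟨w, hw, rfl⟩ | ⟨w, q, α, -, rfl, -⟩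
    -- Splitting `w` replaces it by its two children; a bit string through `w` continues into the
    -- child given by its next bit.
    · refine ⟨(w ++ [false]) :: (w ++ [true]) :: ℓ.filter (· ≠ w), ?_, fun x => ?_⟩
      · intro w' hw'
        simp only [List.mem_cons, List.mem_filter, decide_eq_true_eq] at hw'
        rcases hw' with rfl | rfl | ⟨h3, h4⟩
        · exact hw.child false
        · exact hw.child true
        · exact hw.append_replicative (h1 _ h3) h4
      · obtain ⟨w', h3, h4⟩ := h2 x
        by_cases h5 : w' = w
        · subst h5
          have := starts_append_singleton h4
          refine ⟨_, ?_, this⟩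
          cases x w'.length <;> simp
        · exact ⟨w', by simp [h3, h5], h4⟩
    · exact ⟨ℓ, fun w' hw' => isLeaf_append_nonReplicative_singleton.2 (h1 w' hw'), h2⟩

/-- All threads through a leaf agree. -/
theorem IsLeaf.thread_eq {A : ConstGame} {Φ : Position} (h : Φ ∈ branchLegal A) {w : List Bool}
    (hw : IsLeaf Φ w) {x x' : ℕ → Bool} (hx : Starts w x) (hx' : Starts w x') :
    thread x Φ = thread x' Φ := by
  have key : ∀ Ψ, Ψ <+: Φ → thread x Ψ = thread x' Ψ := by
    intro Ψ
    induction Ψ using List.reverseRecOn with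
    | nil => intro; rfl
    | append_singleton Ψ l ih =>
      intro hΨ
      rw [thread_append, thread_append, ih ((List.prefix_append _ _).trans hΨ)]
      congr 1
      rcases h Ψ l hΨ with ⟨u, -, rfl⟩ | ⟨u, q, α, hu, rfl, -⟩
      · rw [thread_replicative, thread_replicative]
      · have hu' : ActualNode Φ u :=
          hu.mono (List.Subset.trans (List.subset_append_left _ _) hΨ.subset)
        -- No actual node properly extends the leaf `w`, so an actual node met by one string through
        -- `w` is an initial segment of `w` and is met by all of them.
        have h1 : ∀ {y y'}, Starts w y → Starts w y' → Starts u y → Starts u y' := by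
          intro y y' hy hy' huy
          rcases huy.prefix_or_prefix hy with h2 | h2
          · exact hy'.of_prefix h2
          · rw [hw.2 u hu' h2]
            exact hy'
        by_cases hux : Starts u x
        · exact (thread_moves_of_starts hux q [α]).trans
            (thread_moves_of_starts (h1 hx hx' hux) q [α]).symm
        · exact (thread_moves_of_not_starts hux q [α]).trans
            (thread_moves_of_not_starts (fun h2 => hux (h1 hx' hx h2)) q [α]).symm
  exact key Φ List.prefix_rfl

/-- Moves at `w` append the same labmoves to each thread through `w` and do not touch the others, so
legality is a matter of the former threads alone. -/
theorem append_moves_mem_branchLegal {A : ConstGame} {Φ : Position} (h : Φ ∈ branchLegal A)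
    {w : List Bool} (hw : ActualNode Φ w) {p : Player} {L : List Move}
    (hL : ∀ x, Starts w x → thread x Φ ++ L.map (fun α => (p, α)) ∈ A.legal) :
    Φ ++ L.map (fun α => (p, nonReplicative w α)) ∈ branchLegal A := by
  induction L using List.reverseRecOn with
  | nil => simpa using h
  | append_singleton L α ih =>
    rw [List.map_append, ← List.append_assoc]
    simp only [List.map_append, ← List.append_assoc] at hL
    refine branchLegal_append_singleton.2
      ⟨ih fun x hx => A.prefix_legal (List.prefix_append _ _) (hL x hx), Or.inr
        ⟨w, p, α, hw.mono (List.subset_append_left _ _), rfl, fun v => ?_⟩⟩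
    have := hL _ ⟨v, rfl⟩
    have h2 := thread_append (appendBits w v) Φ (L.map fun α => (p, nonReplicative w α))
    rw [thread_moves_of_starts ⟨v, rfl⟩] at h2
    rw [thread] at h2
    rw [h2]
    exact this

/-- If in every thread the player `p` can reach `Q` by legal moves, then it can reach `Q` in all
threads at once by legal moves of the branching recurrence. -/
theorem exists_branch_response {A : ConstGame} {Φ : Position} (h : Φ ∈ branchLegal A)
    (p : Player) (Q : Position → Prop)
    (hQ : ∀ x, ∃ L : List Move, thread x Φ ++ L.map (fun α => (p, α)) ∈ A.legal ∧
      Q (thread x Φ ++ L.map fun α => (p, α))) :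
    ∃ R : List Move, Φ ++ R.map (fun α => (p, α)) ∈ branchLegal A ∧
      ∀ x, Q (thread x (Φ ++ R.map fun α => (p, α))) := by
  obtain ⟨ℓ, h1, h2⟩ := exists_leaves h
  -- The leaves are treated one after another. Along the way the tree stays the same, every thread
  -- can still reach `Q`, and the threads through treated leaves are already there.
  suffices H : ∀ ℓ' : List (List Bool), (∀ w ∈ ℓ', IsLeaf Φ w) →
      ∃ R : List Move, Φ ++ R.map (fun α => (p, α)) ∈ branchLegal A ∧
        (∀ w, IsLeaf (Φ ++ R.map fun α => (p, α)) w ↔ IsLeaf Φ w) ∧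
        (∀ x, ∃ L : List Move,
          thread x (Φ ++ R.map fun α => (p, α)) ++ L.map (fun α => (p, α)) ∈ A.legal ∧
          Q (thread x (Φ ++ R.map fun α => (p, α)) ++ L.map fun α => (p, α))) ∧
        ∀ w ∈ ℓ', ∀ x, Starts w x → Q (thread x (Φ ++ R.map fun α => (p, α))) by
    obtain ⟨R, h3, -, -, h4⟩ := H ℓ h1
    refine ⟨R, h3, fun x => ?_⟩
    obtain ⟨w, h5, h6⟩ := h2 x
    exact h4 w h5 x h6
  intro ℓ'
  induction ℓ' with
  | nil => exact fun _ => ⟨[], by simpa using h, by simp, by simpa using hQ, by simp⟩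
  | cons w ℓ' ih =>
    intro h3
    obtain ⟨R, h4, h5, h6, h7⟩ := ih fun u hu => h3 u (List.mem_cons_of_mem _ hu)
    set Ψ := Φ ++ R.map fun α => (p, α) with hΨ
    have hw : IsLeaf Ψ w := (h5 w).2 (h3 w List.mem_cons_self)
    obtain ⟨L, h8, h9⟩ := h6 (appendBits w fun _ => false)
    -- All threads through `w` agree with the one through `w000…`, so the response `L` found for
    -- that one serves all.
    have h10 : ∀ x, Starts w x → thread x Ψ = thread (appendBits w fun _ => false) Ψ :=
      fun x hx => hw.thread_eq h4 hx ⟨_, rfl⟩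
    have h11 : Φ ++ (R ++ L.map fun α => nonReplicative w α).map (fun α => (p, α)) =
        Ψ ++ L.map fun α => (p, nonReplicative w α) := by
      simp [hΨ, Function.comp_def]
    have h12 := append_moves_mem_branchLegal h4 hw.1 (p := p) (L := L)
      fun x hx => by rw [h10 x hx]; exact h8
    have hin : ∀ x, Starts w x →
        Q (thread x (Ψ ++ L.map fun α => (p, nonReplicative w α))) := by
      intro x hx
      rw [thread_append, thread_moves_of_starts hx, h10 x hx]
      exact h9
    have hout : ∀ x, ¬ Starts w x →
        thread x (Ψ ++ L.map fun α => (p, nonReplicative w α)) = thread x Ψ := by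
      intro x hx
      rw [thread_append, thread_moves_of_not_starts hx, List.append_nil]
    refine ⟨R ++ L.map fun α => nonReplicative w α, ?_, ?_, ?_, ?_⟩ <;> rw [h11]
    · exact h12
    · intro u
      rw [isLeaf_append_nonReplicative, h5]
    · intro x
      by_cases hx : Starts w x
      · exact ⟨[], by simpa using thread_legal h12 x, by simpa using hin x hx⟩
      · rw [hout x hx]
        exact h6 x
    · intro u hu x hux
      by_cases hx : Starts w x
      · exact hin x hx
      · rw [hout x hx]
        rcases List.mem_cons.1 hu with rfl | hu
        · exact absurd hux hx
        · exact h7 u hu x hux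

/-! ### Components of positions -/

/-- The position of the `i`th component of a parallel combination. -/
def component (i : Fin 10) (Φ : Position) : Position := Φ.filterMap (inComponent i)

/-- The negation of a position: all labels are reversed. -/
def negate (Φ : Position) : Position := Φ.map LabMove.neg

/-- The move `i.β`. -/
def componentMove (i : Fin 10) (β : Move) : Move := Key.digit i :: Key.dot :: β

theorem inComponent_self (i : Fin 10) (p : Player) (β : Move) :
    inComponent i (p, componentMove i β) = some (p, β) := by
  simp [inComponent, stripComponent, componentMove]

theorem inComponent_of_ne {i j : Fin 10} (h : i ≠ j) (p : Player) (β : Move) :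
    inComponent i (p, componentMove j β) = none := by
  simp [inComponent, stripComponent, componentMove, h.symm]

theorem exists_of_inComponent {i : Fin 10} {p : Player} {μ : Move}
    (h : (inComponent i (p, μ)).isSome) : ∃ β, μ = componentMove i β := by
  match μ, h with
  | [], h => simp [inComponent, stripComponent] at h
  | [_], h => simp [inComponent, stripComponent] at h
  | k :: l :: β, h =>
    by_cases hk : k = Key.digit i ∧ l = Key.dot
    · exact ⟨β, by rw [hk.1, hk.2]; rfl⟩
    · simp [inComponent, stripComponent, hk] at h

theorem component_append (i : Fin 10) (Φ Ψ : Position) :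
    component i (Φ ++ Ψ) = component i Φ ++ component i Ψ := List.filterMap_append

theorem negate_append (Φ Ψ : Position) : negate (Φ ++ Ψ) = negate Φ ++ negate Ψ :=
  List.map_append

theorem component_self (i : Fin 10) (p : Player) (L : List Move) :
    component i (L.map fun β => (p, componentMove i β)) = L.map fun β => (p, β) := by
  simp only [component, List.filterMap_map]
  rw [← List.filterMap_eq_map']
  congr 1
  funext β
  exact inComponent_self i p β

theorem component_of_ne {i j : Fin 10} (h : i ≠ j) (p : Player) (L : List Move) :
    component i (L.map fun β => (p, componentMove j β)) = [] := by
  simp [component, inComponent_of_ne h]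

theorem component_singleton_self (i : Fin 10) (p : Player) (β : Move) :
    component i [(p, componentMove i β)] = [(p, β)] := component_self i p [β]

theorem component_singleton_of_ne {i j : Fin 10} (h : i ≠ j) (p : Player) (β : Move) :
    component i [(p, componentMove j β)] = [] := component_of_ne h p [β]

theorem negate_moves (p : Player) (L : List Move) :
    negate (L.map fun β => (p, β)) = L.map fun β => (p.other, β) := by
  simp [negate, LabMove.neg, Function.comp_def]

theorem negate_singleton (p : Player) (β : Move) : negate [(p, β)] = [(p.other, β)] := rfl

/-- All moves of the position are made in one of the two components. -/
def WellFormed (Φ : Position) : Prop :=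
  ∀ l ∈ Φ, (inComponent 1 l).isSome ∨ (inComponent 2 l).isSome

theorem WellFormed.append {Φ Ψ : Position} (h : WellFormed Φ) (h' : WellFormed Ψ) :
    WellFormed (Φ ++ Ψ) := by
  intro l hl
  rcases List.mem_append.1 hl with hl | hl
  · exact h l hl
  · exact h' l hl

theorem wellFormed_one (p : Player) (L : List Move) :
    WellFormed (L.map fun β => (p, componentMove 1 β)) := by
  intro l hl
  obtain ⟨β, -, rfl⟩ := List.mem_map.1 hl
  left
  rw [inComponent_self]
  rfl

theorem wellFormed_two (p : Player) (L : List Move) :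
    WellFormed (L.map fun β => (p, componentMove 2 β)) := by
  intro l hl
  obtain ⟨β, -, rfl⟩ := List.mem_map.1 hl
  right
  rw [inComponent_self]
  rfl

theorem WellFormed.last {Φ : Position} {p : Player} {μ : Move}
    (h : WellFormed (Φ ++ [(p, μ)])) : ∃ β, μ = componentMove 1 β ∨ μ = componentMove 2 β := by
  rcases h (p, μ) (by simp) with h | h
  · obtain ⟨β, rfl⟩ := exists_of_inComponent h
    exact ⟨β, Or.inl rfl⟩
  · obtain ⟨β, rfl⟩ := exists_of_inComponent h
    exact ⟨β, Or.inr rfl⟩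

/-! ### The threads of `!(P → P ∧ P)` -/

/-- The constant game `P → P ∧ P`. -/
noncomputable def duplication (P : ConstGame) : ConstGame := P.neg.por (P.pand P)

theorem mem_duplication_legal {P : ConstGame} {T : Position} :
    T ∈ (duplication P).legal ↔ WellFormed T ∧ negate (component 1 T) ∈ P.legal ∧
      WellFormed (component 2 T) ∧ component 1 (component 2 T) ∈ P.legal ∧
      component 2 (component 2 T) ∈ P.legal :=
  Iff.rfl

open Classical in
/-- The answer to the choice of `a` in the antecedent of `P → P ∧ P`: a copy of the answer to
the child of `a` that is in the set `S`. -/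
noncomputable def answer (S : Set ℕ) (a : ℕ) (s₁ s₂ : Option ℕ) : Option ℕ :=
  if 2 * a + 1 ∈ S then s₁ else if 2 * a + 2 ∈ S then s₂ else none

/-- The positions of `P → P ∧ P` at which the strategy against the set `S` aims. -/
def Settled (S : Set ℕ) (T : Position) : Prop :=
  (negate (component 1 T) = [] ∧ component 1 (component 2 T) = [] ∧
    component 2 (component 2 T) = []) ∨
  ∃ (a : ℕ) (s₁ s₂ : Option ℕ), negate (component 1 T) = chosen a (answer S a s₁ s₂) ∧
    component 1 (component 2 T) = chosen (2 * a + 1) s₁ ∧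
    component 2 (component 2 T) = chosen (2 * a + 2) s₂

/-- As long as the machine has not chosen in the goal, the target set is empty and all antecedents
stay unanswered. -/
theorem answer_empty (a : ℕ) (s₁ s₂ : Option ℕ) : answer ∅ a s₁ s₂ = none := by
  simp [answer]

/-- Answering in the antecedent. -/
theorem exists_settle_answer {R : ℕ → ℕ → Prop} {S : Set ℕ} {T : Position}
    (hT : T ∈ (duplication (choiceGame R)).legal) {a : ℕ} {s s₁ s₂ : Option ℕ}
    (h : negate (component 1 T) = chosen a s)
    (h1 : component 1 (component 2 T) = chosen (2 * a + 1) s₁)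
    (h2 : component 2 (component 2 T) = chosen (2 * a + 2) s₂)
    (hs : s = none ∨ s = answer S a s₁ s₂) :
    ∃ L : List Move,
      T ++ L.map (fun α => (Player.machine, α)) ∈ (duplication (choiceGame R)).legal ∧
        Settled S (T ++ L.map fun α => (Player.machine, α)) := by
  by_cases he : s = answer S a s₁ s₂
  · exact ⟨[], by simpa using hT, Or.inr ⟨a, s₁, s₂, by simp [h, he], by simp [h1], by simp [h2]⟩⟩
  · obtain rfl : s = none := hs.resolve_right he
    -- The one missing move is the answer `y` in the antecedent. It carries the label `machine`
    -- because the antecedent is negated.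
    obtain ⟨y, hy⟩ := Option.ne_none_iff_exists'.1 (Ne.symm he)
    have e0 : T ++ [componentMove 1 (numeral y)].map (fun α => (Player.machine, α)) =
      T ++ [(Player.machine, componentMove 1 (numeral y))] := rfl
    have e1 : negate (component 1 (T ++ [(Player.machine, componentMove 1 (numeral y))])) =
        chosen a (some y) := by
      rw [component_append, negate_append, component_singleton_self, h, negate_singleton]
      rfl
    have e2 : component 2 (T ++ [(Player.machine, componentMove 1 (numeral y))]) =
        component 2 T := by
      rw [component_append, component_singleton_of_ne (by decide), List.append_nil]
    refine ⟨[componentMove 1 (numeral y)], ?_, Or.inr ⟨a, s₁, s₂, ?_⟩⟩ <;> rw [e0]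
    · rw [mem_duplication_legal, e1, e2]
      rw [mem_duplication_legal] at hT
      exact ⟨hT.1.append (wellFormed_one _ [numeral y]), chosen_legal _ _, hT.2.2⟩
    · rw [e1, e2, hy]
      exact ⟨rfl, h1, h2⟩

/-- Used when the goal choice fixes the target set: the antecedent has no answer yet, so whatever
`S` demands can still be given. -/
theorem Settled.exists_settle_of_empty {R : ℕ → ℕ → Prop} {T : Position}
    (hT : T ∈ (duplication (choiceGame R)).legal) (h : Settled ∅ T) (S : Set ℕ) :
    ∃ L : List Move,
      T ++ L.map (fun α => (Player.machine, α)) ∈ (duplication (choiceGame R)).legal ∧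
        Settled S (T ++ L.map fun α => (Player.machine, α)) := by
  rcases h with h | ⟨a, s₁, s₂, h, h1, h2⟩
  · exact ⟨[], by simpa using hT, Or.inl (by simpa using h)⟩
  · rw [answer_empty] at h
    exact exists_settle_answer hT h h1 h2 (Or.inl rfl)

/-- The opponent can only choose `a` in the antecedent, which is met by choosing the children of
`a`, or answer in a consequent, which is met by copying the answer back if that child is on the
path. -/
theorem Settled.exists_settle {R : ℕ → ℕ → Prop} {S : Set ℕ} {T : Position} (h : Settled S T)
    {α : Move} (hT : T ++ [(Player.environment, α)] ∈ (duplication (choiceGame R)).legal) :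
    ∃ L : List Move,
      T ++ [(Player.environment, α)] ++ L.map (fun α => (Player.machine, α)) ∈
          (duplication (choiceGame R)).legal ∧
        Settled S (T ++ [(Player.environment, α)] ++ L.map fun α => (Player.machine, α)) := by
  have hT' := mem_duplication_legal.1 hT
  obtain ⟨β, rfl | rfl⟩ := hT'.1.last
  · -- the environment moves in the antecedent
    have e1 : negate (component 1 (T ++ [(Player.environment, componentMove 1 β)])) =
        negate (component 1 T) ++ [(Player.machine, β)] := by
      rw [component_append, negate_append, component_singleton_self]
      rfl
    have e2 : component 2 (T ++ [(Player.environment, componentMove 1 β)]) = component 2 T := by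
      rw [component_append, component_singleton_of_ne (by decide), List.append_nil]
    have hl := hT'.2.1
    rw [e1] at hl
    obtain ⟨h0, a, rfl⟩ := append_machine_legal hl
    rw [h0, List.nil_append] at e1
    -- A choice in the antecedent is the first move there, so the thread was still empty.
    rcases h with ⟨-, h1, h2⟩ | ⟨a', s₁, s₂, h', -, -⟩
    swap
    · rw [h0] at h'
      simp [chosen] at h'
    set T' := T ++ [(Player.environment, componentMove 1 (numeral a))] with hT'def
    set L : List Move := [componentMove 2 (componentMove 1 (numeral (2 * a + 1))),
      componentMove 2 (componentMove 2 (numeral (2 * a + 2)))] with hL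
    have f1 : negate (component 1 (T' ++ L.map fun α => (Player.machine, α))) =
        chosen a none := by
      rw [component_append, negate_append, e1]
      rw [show component 1 (L.map fun α => (Player.machine, α)) = [] from
        component_of_ne (by decide) _ [componentMove 1 (numeral (2 * a + 1)),
          componentMove 2 (numeral (2 * a + 2))]]
      rfl
    have f2 : component 2 (T' ++ L.map fun α => (Player.machine, α)) = component 2 T ++
        [(Player.machine, componentMove 1 (numeral (2 * a + 1))),
          (Player.machine, componentMove 2 (numeral (2 * a + 2)))] := by
      rw [component_append, e2]
      congr 1
    have f3 : component 1 (component 2 (T' ++ L.map fun α => (Player.machine, α))) =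
        chosen (2 * a + 1) none := by
      rw [f2, component_append, h1]
      rfl
    have f4 : component 2 (component 2 (T' ++ L.map fun α => (Player.machine, α))) =
        chosen (2 * a + 2) none := by
      rw [f2, component_append, h2]
      rfl
    refine ⟨L, mem_duplication_legal.2 ⟨?_, ?_, ?_, ?_, ?_⟩,
      Or.inr ⟨a, none, none, ?_, f3, f4⟩⟩
    · exact hT'.1.append (wellFormed_two _ [componentMove 1 (numeral (2 * a + 1)),
          componentMove 2 (numeral (2 * a + 2))])
    · rw [f1]
      exact chosen_legal _ _
    · rw [f2]
      refine WellFormed.append (e2 ▸ hT'.2.2.1) ?_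
      exact (wellFormed_one _ [numeral (2 * a + 1)]).append
        (wellFormed_two _ [numeral (2 * a + 2)])
    · rw [f3]
      exact chosen_legal _ _
    · rw [f4]
      exact chosen_legal _ _
    · rw [f1]
      simp [answer]
  · -- the environment moves in the consequent
    have e1 : negate (component 1 (T ++ [(Player.environment, componentMove 2 β)])) =
        negate (component 1 T) := by
      rw [component_append, component_singleton_of_ne (by decide), List.append_nil]
    have e2 : component 2 (T ++ [(Player.environment, componentMove 2 β)]) =
        component 2 T ++ [(Player.environment, β)] := by
      rw [component_append, component_singleton_self]
    have hw := hT'.2.2.1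
    rw [e2] at hw
    obtain ⟨γ, rfl | rfl⟩ := hw.last
    · have e3 : component 1 (component 2 T ++ [(Player.environment, componentMove 1 γ)]) =
          component 1 (component 2 T) ++ [(Player.environment, γ)] := by
        rw [component_append, component_singleton_self]
      have e4 : component 2 (component 2 T ++ [(Player.environment, componentMove 1 γ)]) =
          component 2 (component 2 T) := by
        rw [component_append, component_singleton_of_ne (by decide), List.append_nil]
      have hl := hT'.2.2.2.1
      rw [e2, e3] at hl
      obtain ⟨c, y, hc, rfl⟩ := append_environment_legal hl
      rcases h with ⟨-, h1, -⟩ | ⟨a, s₁, s₂, h, h1, h2⟩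
      · rw [h1] at hc
        simp [chosen] at hc
      · obtain ⟨-, rfl⟩ := chosen_inj.1 (h1.symm.trans hc)
        refine exists_settle_answer hT (e1.trans h) (s₁ := some y) ?_
          ((congrArg (component 2) e2).trans (e4.trans h2)) ?_
        · rw [e2, e3, h1]
          rfl
        -- This consequent was unanswered before. So the old answer was `none` if it is taken from
        -- here, and otherwise it is unaffected by `y`.
        · unfold answer
          split_ifs <;> simp
    · have e3 : component 2 (component 2 T ++ [(Player.environment, componentMove 2 γ)]) =
          component 2 (component 2 T) ++ [(Player.environment, γ)] := by
        rw [component_append, component_singleton_self]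
      have e4 : component 1 (component 2 T ++ [(Player.environment, componentMove 2 γ)]) =
          component 1 (component 2 T) := by
        rw [component_append, component_singleton_of_ne (by decide), List.append_nil]
      have hl := hT'.2.2.2.2
      rw [e2, e3] at hl
      obtain ⟨c, y, hc, rfl⟩ := append_environment_legal hl
      rcases h with ⟨-, -, h1⟩ | ⟨a, s₁, s₂, h, h1, h2⟩
      · rw [h1] at hc
        simp [chosen] at hc
      · obtain ⟨-, rfl⟩ := chosen_inj.1 (h2.symm.trans hc)
        refine exists_settle_answer hT (e1.trans h) (s₂ := some y)
          ((congrArg (component 1) e2).trans (e4.trans h1)) ?_ ?_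
        · rw [e2, e3, h2]
          rfl
        -- As for the other consequent.
        · unfold answer
          split_ifs <;> simp

/-! ### The environment's strategy in `P ∧ !(P → P ∧ P) → !P` -/

/-- The constant game `P ∧ !(P → P ∧ P) → !P`. -/
noncomputable def production (r : Recurrence) (P : ConstGame) : ConstGame :=
  (P.pand ((duplication P).branch r)).neg.por (P.branch r)

/-- The position of the resource `P`. -/
def resourcePart (Φ : Position) : Position := component 1 (negate (component 1 Φ))

/-- The position of the resource `!(P → P ∧ P)`. -/
def duplicationPart (Φ : Position) : Position := component 2 (negate (component 1 Φ))

/-- The position of the consequent `!P`. -/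
def goalPart (Φ : Position) : Position := component 2 Φ

/-- The resource and duplication parts are read after the outer negation, so there the environment's
moves carry the label `machine`; the goal part keeps the original labels. -/
theorem mem_production_legal {r : Recurrence} {P : ConstGame} {Φ : Position} :
    Φ ∈ (production r P).legal ↔ WellFormed Φ ∧ (WellFormed (negate (component 1 Φ)) ∧
      resourcePart Φ ∈ P.legal ∧ duplicationPart Φ ∈ branchLegal (duplication P)) ∧
      goalPart Φ ∈ branchLegal P :=
  Iff.rfl

/-- Lets one strategy, and hence one run, serve for all predicates. -/
theorem production_legal_eq (r : Recurrence) (R R' : ℕ → ℕ → Prop) :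
    (production r (choiceGame R)).legal = (production r (choiceGame R')).legal := rfl

/-- The chain of ancestors of `m` in the binary tree in which the children of `a` are `2a+1` and
`2a+2`. -/
def ancestors (m : ℕ) : Set ℕ := {c | ∃ k, (fun n => (n - 1) / 2)^[k] m = c}

theorem mem_ancestors_self (m : ℕ) : m ∈ ancestors m := ⟨0, rfl⟩

theorem parent_mem_ancestors {m c a : ℕ} (h : c ∈ ancestors m) (ha : (c - 1) / 2 = a) :
    a ∈ ancestors m := by
  obtain ⟨k, rfl⟩ := h
  exact ⟨k + 1, by rw [Function.iterate_succ_apply', ha]⟩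

/-- Truncated subtraction makes 0 its own parent, so parents never grow. -/
theorem iterate_parent_le (k n : ℕ) : (fun n => (n - 1) / 2)^[k] n ≤ n := by
  induction k with
  | zero => exact le_rfl
  | succ k ih =>
    rw [Function.iterate_succ_apply']
    refine le_trans ?_ ih
    omega

/-- One of two siblings on a path to the root would be an ancestor of the other. But ancestors of
`2a+1` are at most `2a+1`, and proper ancestors of `2a+2` are at most `a`. -/
theorem not_both_children_mem_ancestors {m a : ℕ} (h1 : 2 * a + 1 ∈ ancestors m)
    (h2 : 2 * a + 2 ∈ ancestors m) : False := by
  obtain ⟨k, hk⟩ := h1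
  obtain ⟨l, hl⟩ := h2
  rcases le_or_gt k l with h | h
  · obtain ⟨j, rfl⟩ := Nat.exists_eq_add_of_le' h
    rw [Function.iterate_add_apply, hk] at hl
    have := iterate_parent_le j (2 * a + 1)
    omega
  · obtain ⟨j, rfl⟩ := Nat.exists_eq_add_of_lt h
    rw [show l + j + 1 = (j + 1) + l by ring, Function.iterate_add_apply, hl,
      Function.iterate_succ_apply] at hk
    have := iterate_parent_le j ((2 * a + 2 - 1) / 2)
    omega

/-- The position of `!P` in which the machine has chosen `m` and the environment has answered
`0` in one copy and `1` in another one. -/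
def fork (m : ℕ) : Position :=
  [(Player.machine, nonReplicative [] (numeral m)), (Player.environment, replicative []),
    (Player.environment, nonReplicative [false] (numeral 0)),
    (Player.environment, nonReplicative [true] (numeral 1))]

theorem thread_singleton_of_starts {w : List Bool} {x : ℕ → Bool} (h : Starts w x) (p : Player)
    (α : Move) : thread x [(p, nonReplicative w α)] = [(p, α)] :=
  thread_moves_of_starts h p [α]

theorem thread_singleton_of_not_starts {w : List Bool} {x : ℕ → Bool} (h : ¬ Starts w x)
    (p : Player) (α : Move) : thread x [(p, nonReplicative w α)] = [] :=
  thread_moves_of_not_starts h p [α]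

theorem starts_singleton {b : Bool} {x : ℕ → Bool} : Starts [b] x ↔ b = x 0 := by
  simp [starts_cons, starts_nil]

theorem thread_fork (m : ℕ) (x : ℕ → Bool) :
    thread x (fork m) = chosen m (some (if x 0 then 1 else 0)) := by
  have : fork m = [(Player.machine, nonReplicative [] (numeral m))] ++
      ([(Player.environment, replicative [])] ++
      ([(Player.environment, nonReplicative [false] (numeral 0))] ++
        [(Player.environment, nonReplicative [true] (numeral 1))])) := rfl
  rw [this]
  simp only [thread_append, thread_replicative, thread_singleton_of_starts (starts_nil x)]
  cases hx : x 0 with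
  | false =>
    rw [thread_singleton_of_starts (starts_singleton.2 hx.symm),
      thread_singleton_of_not_starts (by simp [starts_singleton, hx])]
    rfl
  | true =>
    rw [thread_singleton_of_not_starts (by simp [starts_singleton, hx]),
      thread_singleton_of_starts (starts_singleton.2 hx.symm)]
    rfl

theorem fork_mem_branchLegal (R : ℕ → ℕ → Prop) (m : ℕ) :
    fork m ∈ branchLegal (choiceGame R) := by
  have hthread : ∀ x, thread x [(Player.machine, nonReplicative [] (numeral m))] =
      chosen m none := fun x => thread_singleton_of_starts (starts_nil x) _ _
  have h1 : [] ++ [(Player.machine, nonReplicative [] (numeral m))] ∈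
      branchLegal (choiceGame R) :=
    branchLegal_append_singleton.2 ⟨nil_mem_branchLegal _,
      Or.inr ⟨[], _, _, Or.inl rfl, rfl, fun v => chosen_legal m none⟩⟩
  have h2 := branchLegal_append_singleton.2 ⟨h1, Or.inl ⟨[], ⟨Or.inl rfl, ?_⟩, rfl⟩⟩
  · refine (branchLegal_append_singleton
      (Φ := [(Player.machine, nonReplicative [] (numeral m)), (Player.environment, replicative []),
        (Player.environment, nonReplicative [false] (numeral 0))])).2
      ⟨branchLegal_append_singleton.2 ⟨h2, Or.inr ⟨[false], _, _, ?_, rfl, fun v => ?_⟩⟩,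
        Or.inr ⟨[true], _, _, ?_, rfl, fun v => ?_⟩⟩
    · exact Or.inr ⟨[], false, Player.environment, rfl, by simp⟩
    · change thread _ _ ++ _ ∈ _
      rw [List.nil_append, thread_append, hthread, thread_replicative]
      exact chosen_legal m (some 0)
    · exact Or.inr ⟨[], true, Player.environment, rfl, by simp⟩
    · change thread _ ([(Player.machine, nonReplicative [] (numeral m))] ++
        ([(Player.environment, replicative [])] ++
        [(Player.environment, nonReplicative [false] (numeral 0))])) ++ _ ∈ _
      rw [thread_append, thread_append, hthread, thread_replicative,
        thread_singleton_of_not_starts]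
      · exact chosen_legal m (some 1)
      · simp [starts_singleton, appendBits]
  · rintro w' (h | ⟨u, b, p, -, h⟩) -
    · exact h
    · simp only [List.nil_append, List.mem_singleton] at h
      exact absurd (congrArg Prod.snd h) (replicative_ne_nonReplicative _ _ _)

/-- The machine's only possible move in `!P` against the strategy. -/
theorem machine_move_in_goal {R : ℕ → ℕ → Prop} {C : Position} {β : Move}
    (h : C = [] ∨ ∃ m, C = fork m)
    (hl : C ++ [(Player.machine, β)] ∈ branchLegal (choiceGame R)) :
    C = [] ∧ ∃ m, β = nonReplicative [] (numeral m) := by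
  rcases (branchLegal_append_singleton.1 hl).2 with ⟨w, -, h1⟩ | ⟨w, p, α, h1, h2, h3⟩
  · simp at h1
  · obtain ⟨rfl, rfl⟩ := Prod.mk.inj h2
    -- Any thread through `w` shows that the machine has not yet chosen there. This excludes `fork
    -- m`, where every thread contains its choice, and in the empty position the root is the only
    -- node.
    have h4 := append_machine_legal (h3 fun _ => false)
    rcases h with rfl | ⟨m, rfl⟩
    · obtain ⟨-, m, rfl⟩ := h4
      rcases h1 with rfl | ⟨u, b, p, -, h1⟩
      · exact ⟨rfl, m, rfl⟩
      · simp at h1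
    · have h5 := thread_fork m (appendBits w fun _ => false)
      rw [thread, h4.1] at h5
      simp [chosen] at h5

/-- The constants on the path from the root to the machine's choice in the position `C`
of `!P`. -/
def targets (C : Position) : Set ℕ :=
  {c | ∃ m, [(Player.machine, nonReplicative [] (numeral m))] <+: C ∧ c ∈ ancestors m}

theorem targets_nil : targets [] = ∅ := by
  simp [targets]

/-- The positions at which the environment's strategy aims. -/
structure OnTrack (Φ : Position) : Prop where
  resource : resourcePart Φ = [] ∨ ∃ s, resourcePart Φ = chosen 0 s
  goal : goalPart Φ = [] ∨ ∃ m, goalPart Φ = fork m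
  settled : ∀ x, Settled (targets (goalPart Φ)) (thread x (duplicationPart Φ))

theorem onTrack_nil : OnTrack [] :=
  ⟨Or.inl rfl, Or.inl rfl, fun _ => Or.inl ⟨rfl, rfl, rfl⟩⟩

/-- The moves `L₁` in `P`, `L₂` in `!(P → P ∧ P)` and `L₃` in the consequent `!P`. -/
def combine (L₁ L₂ L₃ : List Move) : List Move :=
  (L₁.map (componentMove 1) ++ L₂.map (componentMove 2)).map (componentMove 1) ++
    L₃.map (componentMove 2)

theorem combine_labelled (L₁ L₂ L₃ : List Move) :
    (combine L₁ L₂ L₃).map (fun α => (Player.environment, α)) =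
      ((L₁.map (componentMove 1) ++ L₂.map (componentMove 2)).map fun β =>
        (Player.environment, componentMove 1 β)) ++
      L₃.map fun β => (Player.environment, componentMove 2 β) := by
  simp [combine, Function.comp_def]

theorem negate_component_combine (Φ : Position) (L₁ L₂ L₃ : List Move) :
    negate (component 1 (Φ ++ (combine L₁ L₂ L₃).map fun α => (Player.environment, α))) =
      negate (component 1 Φ) ++ ((L₁.map fun β => (Player.machine, componentMove 1 β)) ++
        L₂.map fun β => (Player.machine, componentMove 2 β)) := by
  rw [combine_labelled, component_append, component_append, component_self,
    component_of_ne (by decide), List.append_nil, negate_append, negate_moves]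
  simp [Player.other, Function.comp_def]

theorem resourcePart_combine (Φ : Position) (L₁ L₂ L₃ : List Move) :
    resourcePart (Φ ++ (combine L₁ L₂ L₃).map fun α => (Player.environment, α)) =
      resourcePart Φ ++ L₁.map fun β => (Player.machine, β) := by
  rw [resourcePart, negate_component_combine, component_append, component_append, component_self,
    component_of_ne (by decide), List.append_nil]
  rfl

theorem duplicationPart_combine (Φ : Position) (L₁ L₂ L₃ : List Move) :
    duplicationPart (Φ ++ (combine L₁ L₂ L₃).map fun α => (Player.environment, α)) =
      duplicationPart Φ ++ L₂.map fun β => (Player.machine, β) := by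
  rw [duplicationPart, negate_component_combine, component_append, component_append,
    component_self, component_of_ne (by decide), List.nil_append]
  rfl

theorem goalPart_combine (Φ : Position) (L₁ L₂ L₃ : List Move) :
    goalPart (Φ ++ (combine L₁ L₂ L₃).map fun α => (Player.environment, α)) =
      goalPart Φ ++ L₃.map fun β => (Player.environment, β) := by
  rw [goalPart, combine_labelled, component_append, component_append,
    component_self, component_of_ne (by decide), List.nil_append]
  rfl

/-- If the environment can respond separately in all parts of the game, it can respond. -/
theorem exists_response {r : Recurrence} {R : ℕ → ℕ → Prop} {Φ : Position}
    (h : Φ ∈ (production r (choiceGame R)).legal)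
    (hA : resourcePart Φ = [] ∨ ∃ s, resourcePart Φ = chosen 0 s) (L₃ : List Move)
    (hL : goalPart Φ ++ L₃.map (fun α => (Player.environment, α)) ∈ branchLegal (choiceGame R))
    (hC : goalPart Φ ++ L₃.map (fun α => (Player.environment, α)) = [] ∨
      ∃ m, goalPart Φ ++ L₃.map (fun α => (Player.environment, α)) = fork m)
    (hB : ∀ x, ∃ L : List Move,
      thread x (duplicationPart Φ) ++ L.map (fun α => (Player.machine, α)) ∈
        (duplication (choiceGame R)).legal ∧
      Settled (targets (goalPart Φ ++ L₃.map fun α => (Player.environment, α)))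
        (thread x (duplicationPart Φ) ++ L.map fun α => (Player.machine, α))) :
    ∃ L : List Move,
      Φ ++ L.map (fun α => (Player.environment, α)) ∈ (production r (choiceGame R)).legal ∧
      OnTrack (Φ ++ L.map fun α => (Player.environment, α)) ∧
      resourcePart (Φ ++ L.map fun α => (Player.environment, α)) ≠ [] := by
  rw [mem_production_legal] at h
  obtain ⟨L₂, h1, h2⟩ := exists_branch_response h.2.1.2.2 Player.machine _ hB
  -- The root 0 is chosen in the resource unless this was done before.
  obtain ⟨L₁, s, h3⟩ : ∃ (L₁ : List Move) (s : Option ℕ),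
      resourcePart Φ ++ L₁.map (fun α => (Player.machine, α)) = chosen 0 s := by
    rcases hA with hA | ⟨s, hA⟩
    · exact ⟨[numeral 0], none, by rw [hA]; rfl⟩
    · exact ⟨[], s, by simp [hA]⟩
  refine ⟨combine L₁ L₂ L₃, mem_production_legal.2 ⟨?_, ⟨?_, ?_, ?_⟩, ?_⟩, ⟨?_, ?_, ?_⟩, ?_⟩
  · refine h.1.append ?_
    rw [combine_labelled]
    exact (wellFormed_one _ _).append (wellFormed_two _ _)
  · rw [negate_component_combine]
    exact h.2.1.1.append ((wellFormed_one _ _).append (wellFormed_two _ _))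
  · rw [resourcePart_combine, h3]
    exact chosen_legal _ _
  · rw [duplicationPart_combine]
    exact h1
  · rw [goalPart_combine]
    exact hL
  · rw [resourcePart_combine, h3]
    exact Or.inr ⟨s, rfl⟩
  · rw [goalPart_combine]
    exact hC
  · rw [goalPart_combine, duplicationPart_combine]
    exact h2
  · rw [resourcePart_combine, h3]
    simp [chosen]

/-- Only the opening choice in the resource may still be due. -/
theorem OnTrack.exists_response_of_no_move {r : Recurrence} {R : ℕ → ℕ → Prop} {Φ : Position}
    (h : OnTrack Φ) (hΦ : Φ ∈ (production r (choiceGame R)).legal) :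
    ∃ L : List Move,
      Φ ++ L.map (fun α => (Player.environment, α)) ∈ (production r (choiceGame R)).legal ∧
      OnTrack (Φ ++ L.map fun α => (Player.environment, α)) ∧
      resourcePart (Φ ++ L.map fun α => (Player.environment, α)) ≠ [] := by
  have hl := mem_production_legal.1 hΦ
  refine exists_response hΦ h.resource [] (by simpa using hl.2.2) (by simpa using h.goal)
    fun x => ⟨[], ?_, ?_⟩
  · simpa using thread_legal hl.2.1.2.2 x
  · simpa using h.settled x

/-- A move in the resource can only answer the choice of 0 and needs no reply. A move in the
duplication part adds at most one labmove to each thread, and each thread is settled again. A move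
in the goal is the choice of `m`: the reply completes `fork m`, and all threads catch up with the
new targets `ancestors m`. -/
theorem OnTrack.exists_response_of_move {r : Recurrence} {R : ℕ → ℕ → Prop} {Φ : Position}
    (h : OnTrack Φ) {μ : Move}
    (hΦ : Φ ++ [(Player.machine, μ)] ∈ (production r (choiceGame R)).legal) :
    ∃ L : List Move,
      Φ ++ [(Player.machine, μ)] ++ L.map (fun α => (Player.environment, α)) ∈
        (production r (choiceGame R)).legal ∧
      OnTrack (Φ ++ [(Player.machine, μ)] ++ L.map fun α => (Player.environment, α)) ∧
      resourcePart (Φ ++ [(Player.machine, μ)] ++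
        L.map fun α => (Player.environment, α)) ≠ [] := by
  have hl := mem_production_legal.1 hΦ
  obtain ⟨β, rfl | rfl⟩ := hl.1.last
  · have e1 : negate (component 1 (Φ ++ [(Player.machine, componentMove 1 β)])) =
        negate (component 1 Φ) ++ [(Player.environment, β)] := by
      rw [component_append, negate_append, component_singleton_self]
      rfl
    have e2 : goalPart (Φ ++ [(Player.machine, componentMove 1 β)]) = goalPart Φ := by
      rw [goalPart, component_append, component_singleton_of_ne (by decide), List.append_nil]
      rfl
    have hw := hl.2.1.1
    rw [e1] at hw
    obtain ⟨γ, rfl | rfl⟩ := hw.last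
    · have e3 : resourcePart (Φ ++ [(Player.machine, componentMove 1 (componentMove 1 γ))]) =
          resourcePart Φ ++ [(Player.environment, γ)] := by
        rw [resourcePart, e1, component_append, component_singleton_self]
        rfl
      have e4 : duplicationPart (Φ ++ [(Player.machine, componentMove 1 (componentMove 1 γ))]) =
          duplicationPart Φ := by
        rw [duplicationPart, e1, component_append, component_singleton_of_ne (by decide),
          List.append_nil]
        rfl
      have h1 := hl.2.1.2.1
      rw [e3] at h1
      obtain ⟨c, d, h2, rfl⟩ := append_environment_legal h1
      have h3 : c = 0 := by
        rcases h.resource with h3 | ⟨s, h3⟩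
        · rw [h2] at h3
          simp [chosen] at h3
        · exact (chosen_inj.1 (h2.symm.trans h3)).1
      subst h3
      refine exists_response hΦ (Or.inr ⟨some d, by rw [e3, h2]; rfl⟩) []
        (by simpa using hl.2.2) (by simpa [e2] using h.goal) fun x => ⟨[], ?_, ?_⟩
      · simpa using thread_legal hl.2.1.2.2 x
      · simpa [e2, e4] using h.settled x
    · have e3 : resourcePart (Φ ++ [(Player.machine, componentMove 1 (componentMove 2 γ))]) =
          resourcePart Φ := by
        rw [resourcePart, e1, component_append, component_singleton_of_ne (by decide),
          List.append_nil]
        rfl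
      have e4 : duplicationPart (Φ ++ [(Player.machine, componentMove 1 (componentMove 2 γ))]) =
          duplicationPart Φ ++ [(Player.environment, γ)] := by
        rw [duplicationPart, e1, component_append, component_singleton_self]
        rfl
      have h1 := hl.2.1.2.2
      rw [e4, branchLegal_append_singleton] at h1
      refine exists_response hΦ (by rw [e3]; exact h.resource) []
        (by simpa using hl.2.2) (by simpa [e2] using h.goal) fun x => ?_
      rw [e4, e2]
      simp only [List.map_nil, List.append_nil]
      rcases h1.2.thread x with h2 | ⟨α, h2, h3⟩
      · rw [h2]
        exact ⟨[], by simpa using thread_legal h1.1 x, by simpa using h.settled x⟩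
      · rw [h2]
        exact (h.settled x).exists_settle h3
  · have e1 : component 1 (Φ ++ [(Player.machine, componentMove 2 β)]) = component 1 Φ := by
      rw [component_append, component_singleton_of_ne (by decide), List.append_nil]
    have e2 : goalPart (Φ ++ [(Player.machine, componentMove 2 β)]) =
        goalPart Φ ++ [(Player.machine, β)] := by
      rw [goalPart, component_append, component_singleton_self]
      rfl
    have e3 : resourcePart (Φ ++ [(Player.machine, componentMove 2 β)]) = resourcePart Φ := by
      rw [resourcePart, e1]
      rfl
    have e4 : duplicationPart (Φ ++ [(Player.machine, componentMove 2 β)]) =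
        duplicationPart Φ := by
      rw [duplicationPart, e1]
      rfl
    have h1 := hl.2.2
    rw [e2] at h1
    obtain ⟨h2, m, rfl⟩ := machine_move_in_goal h.goal h1
    have e5 : goalPart (Φ ++ [(Player.machine, componentMove 2 (nonReplicative [] (numeral m)))])
        ++ [replicative [], nonReplicative [false] (numeral 0),
          nonReplicative [true] (numeral 1)].map (fun α => (Player.environment, α)) = fork m := by
      rw [e2, h2]
      rfl
    refine exists_response hΦ (by rw [e3]; exact h.resource)
      [replicative [], nonReplicative [false] (numeral 0), nonReplicative [true] (numeral 1)]
      ?_ ?_ fun x => ?_ <;> rw [e5]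
    · exact fork_mem_branchLegal R m
    · exact Or.inr ⟨m, rfl⟩
    · rw [e4]
      have h3 := h.settled x
      rw [h2, targets_nil] at h3
      refine h3.exists_settle_of_empty ?_ _
      have := thread_legal hl.2.1.2.2 x
      rwa [e4] at this

/-! ### The environment wins -/

theorem targets_mono {C C' : Position} (h : C <+: C') : targets C ⊆ targets C' :=
  fun _ ⟨m, h1, h2⟩ => ⟨m, h1.trans h, h2⟩

theorem targets_fork (m : ℕ) : targets (fork m) = ancestors m := by
  ext c
  constructor
  · rintro ⟨m', h1, h2⟩
    have : m' = m := by
      simpa [fork, nonReplicative, List.cons_prefix_cons, numeral_injective.eq_iff] using h1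
    exact this ▸ h2
  · intro h
    exact ⟨m, by simp [fork, List.cons_prefix_cons], h⟩

theorem goalPart_prefix {Φ Ψ : Position} (h : Φ <+: Ψ) : goalPart Φ <+: goalPart Ψ :=
  h.filterMap _

theorem resourcePart_prefix {Φ Ψ : Position} (h : Φ <+: Ψ) : resourcePart Φ <+: resourcePart Ψ :=
  ((h.filterMap _).map _).filterMap _

theorem duplicationPart_prefix {Φ Ψ : Position} (h : Φ <+: Ψ) :
    duplicationPart Φ <+: duplicationPart Ψ :=
  ((h.filterMap _).map _).filterMap _

/-- Either the machine never moves in the consequent, or its choice there is eventually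
settled. -/
theorem goalPart_eventually {Φ : ℕ → Position} (hmono : ∀ i j, i ≤ j → Φ i <+: Φ j)
    (ht : ∀ k, OnTrack (Φ k)) :
    (∀ k, goalPart (Φ k) = []) ∨ ∃ m K, ∀ k, K ≤ k → goalPart (Φ k) = fork m := by
  by_cases h : ∀ k, goalPart (Φ k) = []
  · exact Or.inl h
  · obtain ⟨K, hK⟩ := not_forall.1 h
    obtain ⟨m, hm⟩ := (ht K).goal.resolve_left hK
    refine Or.inr ⟨m, K, fun k hk => ?_⟩
    have h1 := goalPart_prefix (hmono K k hk)
    rw [hm] at h1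
    rcases (ht k).goal with h2 | ⟨m', h2⟩ <;> rw [h2] at h1 ⊢
    · simp [fork] at h1
    · exact (h1.eq_of_length rfl).symm

/-- The environment wins every thread of `!(P → P ∧ P)`. -/
theorem duplication_wn {S : Set ℕ} {R : ℕ → ℕ → Prop} {T : ℕ → Position} {Γ : Run}
    (hΓ : IsLimit T Γ) (hmono : ∀ i j, i ≤ j → T i <+: T j)
    (hl : ∀ k, T k ∈ (duplication (choiceGame R)).legal) {K : ℕ}
    (hT : ∀ k, K ≤ k → Settled S (T k))
    (hparent : ∀ a, (2 * a + 1 ∈ S ∨ 2 * a + 2 ∈ S) → a ∈ S)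
    (hchild : ∀ a, 2 * a + 1 ∈ S → 2 * a + 2 ∉ S)
    (hR : ∀ c y, c ∉ S → R c y) (hRR : ∀ a c y, a ∈ S → R a y → R c y) :
    (duplication (choiceGame R)).Wn Γ = Player.machine := by
  have hl' := fun k => mem_duplication_legal.1 (hl k)
  have l1 : IsLimit (fun k => component 1 (T k)) (Γ.filterMap (inComponent 1)) :=
    hΓ.filterMap _
  have l2 : IsLimit (fun k => component 2 (T k)) (Γ.filterMap (inComponent 2)) :=
    hΓ.filterMap _
  have l3 : IsLimit (fun k => negate (component 1 (T k))) (Γ.filterMap (inComponent 1)).neg :=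
    l1.neg
  have l4 : IsLimit (fun k => component 1 (component 2 (T k)))
    ((Γ.filterMap (inComponent 2)).filterMap (inComponent 1)) := l2.filterMap _
  have l5 : IsLimit (fun k => component 2 (component 2 (T k)))
    ((Γ.filterMap (inComponent 2)).filterMap (inComponent 2)) := l2.filterMap _
  refine (por_wn (hΓ.legalRun hl)).2 ?_
  rw [neg_wn (A := choiceGame R) (l1.legalRun fun k => (hl' k).2.1),
    pand_wn (A := choiceGame R) (B := choiceGame R) (l2.legalRun fun k => (hl' k).2.2),
    ← imp_iff_not_or, choiceGame_wn (l3.legalRun fun k => (hl' k).2.1),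
    choiceGame_wn (l4.legalRun fun k => (hl' k).2.2.2.1),
    choiceGame_wn (l5.legalRun fun k => (hl' k).2.2.2.2)]
  -- Suppose the antecedent instance of `P` is won: `a` was chosen and `R a b` holds for every
  -- answer `b` given to it. Both consequents have to be won.
  rintro ⟨a, ha, hb⟩
  obtain ⟨k₀, hk₀⟩ := (l3 _).1 ha
  have hprefix : ∀ {i j}, i ≤ j → component 2 (T i) <+: component 2 (T j) :=
    fun h => (hmono _ _ h).filterMap _
  have key : ∀ k, K ≤ k → k₀ ≤ k → ∃ s₁ s₂,
      negate (component 1 (T k)) = chosen a (answer S a s₁ s₂) ∧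
      component 1 (component 2 (T k)) = chosen (2 * a + 1) s₁ ∧
      component 2 (component 2 (T k)) = chosen (2 * a + 2) s₂ := by
    intro k hk hk'
    have h1 : chosen a none <+: negate (component 1 (T k)) :=
      hk₀.trans (((hmono _ _ hk').filterMap _).map _)
    rcases hT k hk with ⟨h2, -⟩ | ⟨a', s₁, s₂, h2, h3, h4⟩
    · rw [h2] at h1
      simp [chosen] at h1
    · rw [h2, chosen_none_prefix] at h1
      subst h1
      exact ⟨s₁, s₂, h2, h3, h4⟩
  have hans : ∀ k b, negate (component 1 (T k)) = chosen a (some b) → R a b :=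
    fun k b h => hb b ((l3 _).2 ⟨k, h ▸ List.prefix_rfl⟩)
  obtain ⟨s₁, s₂, -, h1, h2⟩ := key (max K k₀) (le_max_left _ _) (le_max_right _ _)
  refine ⟨⟨2 * a + 1, (l4 _).2 ⟨max K k₀, ?_⟩, fun y hy => ?_⟩,
    ⟨2 * a + 2, (l5 _).2 ⟨max K k₀, ?_⟩, fun y hy => ?_⟩⟩
  · dsimp only
    rw [h1, chosen_none_prefix]
  · by_cases hS : 2 * a + 1 ∈ S
    · obtain ⟨k, hk⟩ := (l4 _).1 hy
      -- At a stage late enough for `y` to be present and the thread to be settled, `y` has been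
      -- copied as the answer to `a`.
      obtain ⟨s₁, s₂, h3, h4, -⟩ := key (max k (max K k₀)) (by omega) (by omega)
      have h5 := hk.trans ((hprefix (le_max_left k (max K k₀))).filterMap _)
      change _ <+: component 1 (component 2 _) at h5
      rw [h4, chosen_some_prefix] at h5
      rw [answer, if_pos hS, h5.2] at h3
      exact hRR a _ y (hparent a (Or.inl hS)) (hans _ _ h3)
    · exact hR _ _ hS
  · dsimp only
    rw [h2, chosen_none_prefix]
  · by_cases hS : 2 * a + 2 ∈ S
    · obtain ⟨k, hk⟩ := (l5 _).1 hy
      obtain ⟨s₁, s₂, h3, -, h4⟩ := key (max k (max K k₀)) (by omega) (by omega)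
      have h5 := hk.trans ((hprefix (le_max_left k (max K k₀))).filterMap _)
      change _ <+: component 2 (component 2 _) at h5
      rw [h4, chosen_some_prefix] at h5
      -- `2a+1` is not in `S`, so `answer` copies from the second consequent.
      rw [answer, if_neg fun h => hchild a h hS, if_pos hS, h5.2] at h3
      exact hRR a _ y (hparent a (Or.inr hS)) (hans _ _ h3)
    · exact hR _ _ hS

/-- The goal is refuted on the threads `000…` and `100…`, which count for both recurrences. -/
theorem relevant_of_eventually_false (r : Recurrence) (b : Bool) :
    r.Relevant (fun n => if n = 0 then b else false) := by
  cases r with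
  | uncountable => trivial
  | countable =>
    refine (Set.finite_singleton 0).subset fun n hn => ?_
    by_contra h
    simp only [Set.mem_singleton_iff] at h
    simp [h] at hn

/-- The environment wins a run all of whose positions follow the strategy, if the letter is
interpreted suitably. -/
theorem exists_environment_wins (r : Recurrence) {Φ : ℕ → Position} {Γ : Run}
    (hΓ : IsLimit Φ Γ) (hmono : ∀ i j, i ≤ j → Φ i <+: Φ j)
    (hl : ∀ k R, Φ k ∈ (production r (choiceGame R)).legal) (ht : ∀ k, OnTrack (Φ k))
    (hres : ∃ k, resourcePart (Φ k) ≠ []) :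
    ∃ R, (production r (choiceGame R)).Wn Γ ≠ Player.machine := by
  -- `S` is the final target set: empty if the machine never chooses in the goal, and otherwise the
  -- path from its choice to the root.
  obtain ⟨S, K, hS, hparent, hchild⟩ : ∃ (S : Set ℕ) (K : ℕ),
      (∀ k, K ≤ k → targets (goalPart (Φ k)) = S) ∧
      (∀ a, (2 * a + 1 ∈ S ∨ 2 * a + 2 ∈ S) → a ∈ S) ∧
      (∀ a, 2 * a + 1 ∈ S → 2 * a + 2 ∉ S) := by
    rcases goalPart_eventually hmono ht with h | ⟨m, K, h⟩
    · exact ⟨∅, 0, fun k _ => by rw [h k, targets_nil], by simp, by simp⟩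
    · refine ⟨ancestors m, K, fun k hk => by rw [h k hk, targets_fork], ?_,
        fun a h1 h2 => not_both_children_mem_ancestors h1 h2⟩
      rintro a (h1 | h1)
      · exact parent_mem_ancestors h1 (by omega)
      · exact parent_mem_ancestors h1 (by omega)
  -- True off the path; on the path, true exactly for an answer given to 0 in the resource.
  set R : ℕ → ℕ → Prop := fun c y => c ∉ S ∨ ∃ k, chosen 0 (some y) <+: resourcePart (Φ k)
  refine ⟨R, ?_⟩
  have hl' := fun k => mem_production_legal.1 (hl k R)
  have l1 : IsLimit (fun k => component 1 (Φ k)) (Γ.filterMap (inComponent 1)) :=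
    hΓ.filterMap _
  have lC : IsLimit (fun k => goalPart (Φ k)) (Γ.filterMap (inComponent 2)) :=
    hΓ.filterMap _
  have l2 : IsLimit (fun k => negate (component 1 (Φ k))) (Γ.filterMap (inComponent 1)).neg :=
    l1.neg
  have lA : IsLimit (fun k => resourcePart (Φ k))
    ((Γ.filterMap (inComponent 1)).neg.filterMap (inComponent 1)) := l2.filterMap _
  have lB : IsLimit (fun k => duplicationPart (Φ k))
    ((Γ.filterMap (inComponent 1)).neg.filterMap (inComponent 2)) := l2.filterMap _
  rw [production, Ne, por_wn (hΓ.legalRun fun k => hl k R),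
    neg_wn (A := (choiceGame R).pand ((duplication (choiceGame R)).branch r))
      (l1.legalRun fun k => (hl' k).2.1),
    pand_wn (A := choiceGame R) (B := (duplication (choiceGame R)).branch r)
      (l2.legalRun fun k => (hl' k).2.1),
    branch_wn (A := duplication (choiceGame R)) (lB.legalRun fun k => (hl' k).2.1.2.2),
    branch_wn (A := choiceGame R) (lC.legalRun fun k => (hl' k).2.2),
    choiceGame_wn (lA.legalRun fun k => (hl' k).2.1.2.1), not_or, not_not]
  refine ⟨⟨⟨0, ?_, fun d hd => Or.inr ((lA _).1 hd)⟩, fun v _ => ?_⟩, fun hC => ?_⟩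
  · obtain ⟨k, hk⟩ := hres
    obtain ⟨s, hs⟩ := (ht k).resource.resolve_left hk
    refine (lA _).2 ⟨k, ?_⟩
    dsimp only
    rw [hs, chosen_none_prefix]
  · have lv : IsLimit (fun k => thread v (duplicationPart (Φ k)))
      (((Γ.filterMap (inComponent 1)).neg.filterMap (inComponent 2)).filterMap (inThread v)) :=
      lB.filterMap _
    refine duplication_wn lv
      (fun i j hij => (duplicationPart_prefix (hmono i j hij)).filterMap _)
      (fun k => thread_legal (hl' k).2.1.2.2 v) (K := K)
      (fun k hk => hS k hk ▸ (ht k).settled v) hparent hchild (fun c y hc => Or.inl hc)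
      fun a c y ha hy => Or.inr (hy.resolve_left fun h => h ha)
  -- If the machine won the goal, both branches of its fork would be true, that is, `R m 0` and `R m
  -- 1`.
  · have hthread : ∀ b : Bool, ∃ m k, goalPart (Φ k) = fork m ∧ R m (if b then 1 else 0) := by
      intro b
      have h1 := hC _ (relevant_of_eventually_false r b)
      have lv : IsLimit (fun k => thread (fun n => if n = 0 then b else false) (goalPart (Φ k)))
        ((Γ.filterMap (inComponent 2)).filterMap
          (inThread fun n => if n = 0 then b else false)) := lC.filterMap _
      rw [choiceGame_wn (lv.legalRun fun k => thread_legal (hl' k).2.2 _)] at h1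
      obtain ⟨c, h1, h2⟩ := h1
      obtain ⟨k, hk⟩ := (lv _).1 h1
      dsimp only at hk
      rcases (ht k).goal with h3 | ⟨m, h3⟩
      · rw [h3] at hk
        simp [thread, chosen] at hk
      · refine ⟨m, k, h3, ?_⟩
        rw [h3, thread_fork, chosen_none_prefix] at hk
        subst hk
        refine h2 _ ((lv _).2 ⟨k, ?_⟩)
        dsimp only
        rw [h3, thread_fork]
        simp
    -- Since `m` is on its own path, `R m y` can hold only if `y` was the answer in the resource; 0
    -- and 1 cannot both have been.
    have hanswer : ∀ b : Bool, ∃ k,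
        chosen 0 (some (if b then 1 else 0)) <+: resourcePart (Φ k) := by
      intro b
      obtain ⟨m, k, hk, h1 | h1⟩ := hthread b
      · exfalso
        apply h1
        rw [← hS (max k K) (le_max_right _ _)]
        refine targets_mono (goalPart_prefix (hmono k _ (le_max_left _ _))) ?_
        rw [hk, targets_fork]
        exact mem_ancestors_self m
      · exact h1
    obtain ⟨i, hi⟩ := hanswer false
    obtain ⟨j, hj⟩ := hanswer true
    have hi' := hi.trans (resourcePart_prefix (hmono i (max i j) (le_max_left _ _)))
    have hj' := hj.trans (resourcePart_prefix (hmono j (max i j) (le_max_right _ _)))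
    rcases (ht (max i j)).resource with h | ⟨s, h⟩ <;> rw [h] at hi' hj'
    · simp [chosen] at hi'
    · rw [chosen_some_prefix] at hi' hj'
      have := hi'.2.symm.trans hj'.2
      simp at this

/-! ### The run of a machine against the strategy -/

open Classical in
/-- The environment's response in the position `Φ`: if possible, legal moves that keep to the
strategy. -/
noncomputable def response (r : Recurrence) (Φ : Position) : List Move :=
  if h : ∃ L : List Move,
      Φ ++ L.map (fun α => (Player.environment, α)) ∈
        (production r (choiceGame fun _ _ => True)).legal ∧
      OnTrack (Φ ++ L.map fun α => (Player.environment, α)) ∧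
      resourcePart (Φ ++ L.map fun α => (Player.environment, α)) ≠ []
  then h.choose else []

/-- The configurations of the machine `M` against the environment's strategy. -/
noncomputable def counterConfig (M : HPM) (e : Valuation) (r : Recurrence) : ℕ → M.Config
  | 0 => M.init
  | k + 1 =>
    { M.next e (counterConfig M e r k) with
      position := (counterConfig M e r k).position ++
        ([] : List Move).map (fun α => (Player.environment, α)) ++
        (M.next e (counterConfig M e r k)).moveMade ++
        (response r ((counterConfig M e r k).position ++
          (M.next e (counterConfig M e r k)).moveMade)).map fun α => (Player.environment, α) }

/-- The computation branch of the machine `M` against the environment's strategy. -/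
noncomputable def counterBranch (M : HPM) (e : Valuation) (r : Recurrence) : M.Branch e where
  config := counterConfig M e r
  config_zero := rfl
  config_succ k := ⟨[], response r ((counterConfig M e r k).position ++
    (M.next e (counterConfig M e r k)).moveMade), rfl⟩

/-- No machine wins `P ∧ !(P → P ∧ P) → !P` for all predicates. -/
theorem exists_not_wn_counterBranch (M : HPM) (e : Valuation) (r : Recurrence) :
    ∃ R, (production r (choiceGame R)).Wn (counterBranch M e r).run ≠ Player.machine := by
  set Φ : ℕ → Position := fun k => (counterConfig M e r k).position with hΦ
  set W := (production r (choiceGame fun _ _ => True)).legal with hW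
  -- Each step either continues the strategy or contains an illegal move of the machine, so the
  -- default value of `response` is never used while the play is legal and on track.
  have hstep : ∀ k, Φ k ∈ W → OnTrack (Φ k) →
      (Φ (k + 1) ∈ W ∧ OnTrack (Φ (k + 1)) ∧ resourcePart (Φ (k + 1)) ≠ []) ∨
      ∃ μ, Φ k ++ [(Player.machine, μ)] ∉ W ∧ Φ k ++ [(Player.machine, μ)] <+: Φ (k + 1) := by
    intro k hk ht
    have hsucc : Φ (k + 1) = Φ k ++ (M.next e (counterConfig M e r k)).moveMade ++
        (response r (Φ k ++ (M.next e (counterConfig M e r k)).moveMade)).map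
          fun α => (Player.environment, α) := by
      simp [hΦ, counterConfig]
    by_cases hm : (M.next e (counterConfig M e r k)).state ∈ M.moveStates
    · simp only [HPM.Config.moveMade, if_pos hm] at hsucc
      by_cases hleg : Φ k ++ [(Player.machine, (M.next e (counterConfig M e r k)).buffer)] ∈ W
      · left
        have h := ht.exists_response_of_move hleg
        rw [hsucc, response, dif_pos h]
        exact h.choose_spec
      · exact Or.inr ⟨_, hleg, hsucc ▸ List.prefix_append _ _⟩
    · simp only [HPM.Config.moveMade, if_neg hm, List.append_nil] at hsucc
      left
      have h := ht.exists_response_of_no_move hk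
      rw [hsucc, response, dif_pos h]
      exact h.choose_spec
  by_cases hill : ∃ k μ, Φ k ∈ W ∧ Φ k ++ [(Player.machine, μ)] ∉ W ∧
      Φ k ++ [(Player.machine, μ)] <+: Φ (k + 1)
  · obtain ⟨k, μ, h1, h2, h3⟩ := hill
    -- An illegal move loses whatever the predicate is, so the constant one will do.
    refine ⟨fun _ _ => True, ?_⟩
    have h4 : Φ k ++ [(Player.machine, μ)] ∈ (counterBranch M e r).run.positions := ⟨k + 1, h3⟩
    rw [(production r (choiceGame fun _ _ => True)).wn_illegal Player.machine _
      ⟨Φ k, μ, h4, h1, h2⟩]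
    simp [Player.other]
  · have hall : ∀ k, Φ k ∈ W ∧ OnTrack (Φ k) := by
      intro k
      induction k with
      | zero => exact ⟨ConstGame.nil_legal _, onTrack_nil⟩
      | succ k ih =>
        rcases hstep k ih.1 ih.2 with h | ⟨μ, h1, h2⟩
        · exact ⟨h.1, h.2.1⟩
        · exact absurd ⟨k, μ, ih.1, h1, h2⟩ hill
    refine exists_environment_wins r (fun _ => Iff.rfl)
      (fun i j hij => (counterBranch M e r).position_prefix hij)
      (fun k R => production_legal_eq r (fun _ _ => True) R ▸ (hall k).1) (fun k => (hall k).2)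
      ⟨1, ?_⟩
    -- The choice in the resource is made in the very first step.
    rcases hstep 0 (hall 0).1 (hall 0).2 with h | ⟨μ, h1, h2⟩
    · exact h.2.2
    · exact absurd ⟨0, μ, (hall 0).1, h1, h2⟩ hill

/-! ### Interpretations -/

/-- The interpretation that sends every letter to the predicate `R` of the first two
variables. -/
def binaryInterpretation (R : ℕ → ℕ → Prop) : Interpretation where
  tuple _ _ j := j.val
  tuple_injective _ _ := Fin.val_injective
  holds _ _ e := R (e 0) (e 1)

/-- Since `x ≠ y`, the choice for `y` does not overwrite the value chosen for `x`. -/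
theorem choiceFormula_toGame (R : ℕ → ℕ → Prop) (p : ℕ) {x y : Var} (hxy : x ≠ y)
    (e : Valuation) : (choiceFormula p x y).toGame (binaryInterpretation R) e = choiceGame R := by
  have h : ∀ (f : Fin 2 → ℕ) (e' : Valuation) (j : Fin 2),
      Function.extend (fun j : Fin 2 => j.val) f e' j.val = f j :=
    fun f e' j => Fin.val_injective.extend_apply f e' j
  have h0 := fun f e' => h f e' 0
  have h1 := fun f e' => h f e' 1
  simp only [Fin.val_zero, Fin.val_one] at h0 h1
  simp [choiceFormula, Formula.toGame, binaryInterpretation, choiceGame, h0, h1, Term.eval,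
    Function.update_of_ne hxy]

/-- The only letter of the formula is binary; its attached tuple consists of the variables 0 and 1,
the only ones on which the predicate depends. -/
theorem binaryInterpretation_admissible (R : ℕ → ℕ → Prop) (r : Recurrence) (p : ℕ) (x y : Var) :
    (binaryInterpretation R).Admissible (shortProduction r (choiceFormula p x y)) := by
  intro n i hni z _ hz
  have hn : n = 2 := by
    have : (n, i) = (2, p) := by
      simpa [shortProduction, choiceFormula, Formula.imp, Formula.letters] using hni
    exact congrArg Prod.fst this
  subst hn
  rintro ⟨e, e', h1, h2⟩
  apply h2
  have hz0 : 0 ≠ z := fun h => hz ⟨0, h⟩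
  have hz1 : 1 ≠ z := fun h => hz ⟨1, h⟩
  simp only [binaryInterpretation, h1 0 hz0, h1 1 hz1]

theorem not_uniformlyValid_shortProduction (r : Recurrence) (p : ℕ) {x y : Var} (hxy : x ≠ y) :
    ¬ UniformlyValid (shortProduction r (choiceFormula p x y)) := by
  rintro ⟨M, hM⟩
  -- The valuation is immaterial, since the resulting game does not depend on it.
  obtain ⟨R, hR⟩ := exists_not_wn_counterBranch M (fun _ => 0) r
  apply hR
  have h := hM (binaryInterpretation R) (binaryInterpretation_admissible R r p x y) (fun _ => 0)
    (counterBranch M (fun _ => 0) r)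
  simpa only [shortProduction, Formula.imp, Formula.toGame, choiceFormula_toGame R p hxy,
    production, duplication] using h

end CoL

theorem mainTheorem3 (p : ℕ) (x y : CoL.Var) (hxy : x ≠ y) :
    ¬ CoL.UniformlyValid
        (CoL.shortProduction CoL.Recurrence.uncountable (CoL.choiceFormula p x y)) ∧
    ¬ CoL.UniformlyValid
        (CoL.shortProduction CoL.Recurrence.countable (CoL.choiceFormula p x y)) :=
  ⟨CoL.not_uniformlyValid_shortProduction _ p hxy, CoL.not_uniformlyValid_shortProduction _ p hxy⟩
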